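/- Setting. Let $\mathcal A=\{1,\dots,K\}$ be the set of arms, and for rounds $t=1,2,\dots$ let $S_t,X_t$ be random vectors in $\mathbb R^d$ (unobserved state and observed noisy context), $\eta_t$ a real random variable, $X_t=S_t+\varepsilon_t$, and let the potential outcomes be $Y_t(a)=S_t^\top\theta_a^*+\eta_t$, $a\in\mathcal A$. Assume $\mathbb E[\varepsilon_t\mid S_t]=0$, $\mathrm{Var}(\varepsilon_t\mid S_t)=\Sigma_e$ for a known constant matrix $\Sigma_e$, and $\mathbb E[\eta_t\mid S_t,X_t]=0$; write $\sigma_\eta^2=\mathrm{Var}(\eta_t\mid S_t,X_t)$ (possibly a function of $(S_t,X_t)$). The vectors $(X_t,(Y_t(a))_{a\in\mathcal A})$ are i.i.d. over $t$, and for each $t$ the vector $(X_t,(Y_t(a))_{a})$ is independent of the history $\mathcal H_{t-1}=(X_\tau,\pi_\tau(A_\tau),A_\tau,Y_\tau)_{\tau<t}$. In round $t$ an action $A_t$ is drawn from a behavior policy, $\mathbb P(A_t=a\mid\mathcal H_{t-1},X_t)=\pi_t(a)=\pi_t(a\mid X_t,\mathcal H_{t-1})$, and $Y_t=Y_t(A_t)$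 is observed. Assume: (i) (unconfoundedness) $A_t\perp\{Y_t(a)\}_{a\in\mathcal A}\mid(\mathcal H_{t-1},X_t)$ for all $t$; (ii) there are constants $M,M_\eta$ with $\max\{\|X_t\|_2,\|S_t\|_2\}\le M$ and $\mathbb E[\eta_t^4\mid S_t,X_t]\le M_\eta$ almost surely, and $\Sigma_S=\mathbb E[S_tS_t^\top]$ is invertible; (iii) there is $\pi_{\min}\in(0,1)$ with $\pi_t(a)\ge\pi_{\min}$ almost surely for all $t,a$; (iv) there is a stationary policy $\bar\pi$ such that $\pi_t(a)-\bar\pi(a\mid X_t)\to0$ in probability as $t\to\infty$, for every $a\in\mathcal A$. Estimators. For each $a$, consider estimators $\hat\theta_a^{(T)}$ satisfying $$\frac1T\sum_{t=1}^T\frac{1_{\{A_t=a\}}}{\pi_t(A_t)}\big[X_tY_t-(X_tX_t^\top-\Sigma_e)\hat\theta_a^{(T)}\big]=o_p(1/\sqrt T).\qquad(*)$$ Claim. The bias-corrected inverse probability weighted estimators $$\Big[\frac1T\sum_{t=1}^T\frac{1_{\{A_t=a\}}}{\pi_t(A_t)}(X_tX_t^\top-\Sigma_e)\Big]^{-1}\Big(\frac1T\sum_{t=1}^T\frac{1_{\{A_t=a\}}}{\pi_t(A_t)}X_tY_t\Big)$$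 satisfy $(*)$ for every $a$ (with the convention that the inverse of a singular matrix is $0$). Moreover, for any estimators satisfying $(*)$ for every $a$, with $\hat\theta^{(T)}$ and $\theta^*$ denoting the vectors obtained by stacking $\hat\theta^{(T)}_1,\dots,\hat\theta^{(T)}_K$ and $\theta_1^*,\dots,\theta_K^*$, as $T\to\infty$, $$\sqrt T\big(\hat\theta^{(T)}-\theta^*\big)\xrightarrow{d}\mathcal N\big(0,\mathrm{diag}(\Sigma_1^*,\dots,\Sigma_K^*)\big),\qquad \Sigma_a^*=\Sigma_S^{-1}\bar I_a\Sigma_S^{-1},$$ where the block-diagonal matrix $\mathrm{diag}(\Sigma_1^*,\dots,\Sigma_K^*)$ is positive semidefinite, $$\bar I_a=\mathbb E\Big[\frac1{\bar\pi(a\mid X_t)}\big(h_a(X_t,S_t)h_a(X_t,S_t)^\top+\sigma_\eta^2X_tX_t^\top\big)\Big],\qquad h_a(x,s)=(xx^\top-\Sigma_e)\theta_a^*-xs^\top\theta_a^*.$$ Finally, for every $a$ the matrix $\hat\Sigma_a=\hat{\dot G}_{a,T}^{-1}\,\hat I_{a,T}\,(\hat{\dot G}_{a,T}^{-1})^\top$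 converges in probability to $\Sigma_a^*$, where $$\hat{\dot G}_{a,T}=\frac1T\sum_{t=1}^T\frac{1_{\{A_t=a\}}}{\pi_t(A_t)}(X_tX_t^\top-\Sigma_e),\qquad \hat I_{a,T}=\frac1T\sum_{t=1}^T\frac{1_{\{A_t=a\}}}{\pi_t(A_t)^2}\,v_tv_t^\top,\quad v_t=(X_tX_t^\top-\Sigma_e)\hat\theta_a^{(T)}-X_tY_t .$$ -/

import Mathlib

open MeasureTheory ProbabilityTheory Filter
open scoped Matrix Topology

noncomputable section

namespace NoisyBandit

/-- Contexts and parameters live in `ℝ^d` with the Euclidean norm. -/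
abbrev Vec (d : ℕ) := EuclideanSpace ℝ (Fin d)

/-- What is recorded in one round: observed context, realized selection probability of the chosen
action, chosen action, observed outcome. -/
abbrev Rec (d K : ℕ) := Vec d × ℝ × Fin K × ℝ

/-- A (possibly history dependent) behavior policy: `prob t h x a` is the probability with which
action `a` is selected in round `t` (rounds are numbered from `0`), given the `t` past records `h`
and the current context `x`. -/
structure BehaviorPolicy (d K : ℕ) where
  prob : (t : ℕ) → (Fin t → Rec d K) → Vec d → Fin K → ℝ
  measurable_prob : ∀ t a,
    Measurable fun hx : (Fin t → Rec d K) × Vec d => prob t hx.1 hx.2 a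
  prob_nonneg : ∀ t h x a, 0 ≤ prob t h x a
  sum_prob : ∀ t h x, ∑ a, prob t h x a = 1

/-- A stationary policy: `prob x a` is the probability of action `a` in context `x`. -/
structure StationaryPolicy (d K : ℕ) where
  prob : Vec d → Fin K → ℝ
  measurable_prob : ∀ a, Measurable fun x => prob x a
  prob_nonneg : ∀ x a, 0 ≤ prob x a
  sum_prob : ∀ x, ∑ a, prob x a = 1

/-- The raw ingredients of a linear bandit with noisy contexts on a sample space `Ω`.
The conditions they satisfy are collected in `IsNoisyContextBandit` and `Regular` below. -/
structure Model (d K : ℕ) (Ω : Type*) where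
  /-- true reward parameter `θ_a^*` of each arm -/
  theta : Fin K → Vec d
  /-- covariance matrix `Σ_e` of the context noise -/
  SigmaE : Matrix (Fin d) (Fin d) ℝ
  /-- unobserved states `S_t` -/
  S : ℕ → Ω → Vec d
  /-- observed noisy contexts `X_t` -/
  X : ℕ → Ω → Vec d
  /-- reward noise `η_t` -/
  eta : ℕ → Ω → ℝ
  /-- selected actions `A_t` -/
  A : ℕ → Ω → Fin K
  /-- behavior policy -/
  policy : BehaviorPolicy d K

/-- Conditional independence of the random variables `U` and `V` given the σ-algebra `m`, on an
arbitrary probability space: conditional probabilities of rectangles factorize. -/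
def CondIndepGiven {Ω α β : Type*} [MeasurableSpace α] [MeasurableSpace β]
    (m : MeasurableSpace Ω) {mΩ : MeasurableSpace Ω} (U : Ω → α) (V : Ω → β)
    (μ : Measure Ω) : Prop :=
  ∀ B : Set α, ∀ C : Set β, MeasurableSet B → MeasurableSet C →
    μ[(U ⁻¹' B ∩ V ⁻¹' C).indicator (fun _ => (1 : ℝ)) | m] =ᵐ[μ]
      fun ω => (μ[(U ⁻¹' B).indicator (fun _ => (1 : ℝ)) | m]) ω *
        (μ[(V ⁻¹' C).indicator (fun _ => (1 : ℝ)) | m]) ω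

/-- `x xᵀ`. -/
def outer {d : ℕ} (x : Vec d) : Matrix (Fin d) (Fin d) ℝ :=
  Matrix.vecMulVec x.ofLp x.ofLp

namespace Model

variable {d K : ℕ} {Ω : Type*}

/-- Context noise `ε_t = X_t - S_t`. -/
def eps (M : Model d K Ω) (t : ℕ) (ω : Ω) : Vec d := M.X t ω - M.S t ω

/-- Potential outcomes `Y_t(a) = S_tᵀ θ_a^* + η_t`. -/
def potentialOutcome (M : Model d K Ω) (t : ℕ) (ω : Ω) (a : Fin K) : ℝ :=
  inner ℝ (M.S t ω) (M.theta a) + M.eta t ω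

/-- Observed outcome `Y_t = Y_t(A_t)`. -/
def Y (M : Model d K Ω) (t : ℕ) (ω : Ω) : ℝ := M.potentialOutcome t ω (M.A t ω)

/-- The history before round `t`: the records `(X_τ, π_τ(A_τ), A_τ, Y_τ)` for `τ < t`. -/
def history (M : Model d K Ω) : (t : ℕ) → Ω → (Fin t → Rec d K)
  | 0, _ => Fin.elim0
  | t + 1, ω => Fin.snoc (α := fun _ => Rec d K) (M.history t ω)
      (M.X t ω, M.policy.prob t (M.history t ω) (M.X t ω) (M.A t ω), M.A t ω, M.Y t ω)

/-- `π_t(a)`: the selection probability of action `a` in round `t`, given the history before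
round `t` and the context `X_t`. -/
def selProb (M : Model d K Ω) (t : ℕ) (a : Fin K) (ω : Ω) : ℝ :=
  M.policy.prob t (M.history t ω) (M.X t ω) a

/-- The σ-algebra generated by the history before round `t` and the context `X_t`. -/
abbrev histCtx (M : Model d K Ω) (t : ℕ) : MeasurableSpace Ω :=
  MeasurableSpace.comap (fun ω => (M.history t ω, M.X t ω)) inferInstance

/-- The σ-algebra generated by `S_t`. -/
abbrev sigmaS (M : Model d K Ω) (t : ℕ) : MeasurableSpace Ω :=
  MeasurableSpace.comap (M.S t) inferInstance

/-- The σ-algebra generated by `(S_t, X_t)`. -/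
abbrev sigmaSX (M : Model d K Ω) (t : ℕ) : MeasurableSpace Ω :=
  MeasurableSpace.comap (fun ω => (M.S t ω, M.X t ω)) inferInstance

/-- The second moment matrix `Σ_S = E[S_t S_tᵀ]`. -/
def SigmaS {mΩ : MeasurableSpace Ω} (M : Model d K Ω) (μ : Measure Ω) (t : ℕ) :
    Matrix (Fin d) (Fin d) ℝ :=
  Matrix.of fun i j => ∫ ω, outer (M.S t ω) i j ∂μ

/-- The contextual bandit with noisy contexts: stochastic environment, adaptive data collection,
unconfoundedness and measurement error model. -/
structure IsNoisyContextBandit {mΩ : MeasurableSpace Ω} (M : Model d K Ω) (μ : Measure Ω) :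
    Prop where
  measurable_S : ∀ t, Measurable (M.S t)
  measurable_X : ∀ t, Measurable (M.X t)
  measurable_eta : ∀ t, Measurable (M.eta t)
  measurable_A : ∀ t, Measurable (M.A t)
  /-- the pairs `(X_t, (Y_t(a))_a)` are independent over time ... -/
  indep : iIndepFun (fun t ω => (M.X t ω, M.potentialOutcome t ω)) μ
  /-- ... and identically distributed -/
  identDistrib : ∀ s t, IdentDistrib (fun ω => (M.X s ω, M.potentialOutcome s ω))
    (fun ω => (M.X t ω, M.potentialOutcome t ω)) μ μ
  /-- the environment's draw in round `t` is independent of what was recorded before -/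
  indep_history : ∀ t,
    IndepFun (fun ω => (M.X t ω, M.potentialOutcome t ω)) (M.history t) μ
  /-- actions are drawn from the behavior policy -/
  action_law : ∀ t a,
    μ[(M.A t ⁻¹' {a}).indicator (fun _ => (1 : ℝ)) | M.histCtx t] =ᵐ[μ] M.selProb t a
  /-- unconfoundedness: `A_t` and the potential outcomes are conditionally independent given the
  history and the context -/
  unconfounded : ∀ t, CondIndepGiven (M.histCtx t) (M.A t) (M.potentialOutcome t) μ
  /-- `E[ε_t | S_t] = 0` -/
  eps_mean : ∀ t i, μ[fun ω => M.eps t ω i | M.sigmaS t] =ᵐ[μ] 0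
  /-- `Var(ε_t | S_t) = E[ε_t ε_tᵀ | S_t] = Σ_e` -/
  eps_var : ∀ t i j,
    μ[fun ω => outer (M.eps t ω) i j | M.sigmaS t] =ᵐ[μ] fun _ => M.SigmaE i j
  /-- `E[η_t | S_t, X_t] = 0` -/
  eta_mean : ∀ t, μ[M.eta t | M.sigmaSX t] =ᵐ[μ] 0

/-- Regularity: bounded contexts and states, bounded conditional fourth moment of the reward
noise, invertible second moment matrix of the state. -/
structure Regular {mΩ : MeasurableSpace Ω} (M : Model d K Ω) (μ : Measure Ω) : Prop where
  bounded : ∃ C : ℝ, ∀ t, ∀ᵐ ω ∂μ, max ‖M.X t ω‖ ‖M.S t ω‖ ≤ C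
  integrable_eta : ∀ t, Integrable (fun ω => M.eta t ω ^ 4) μ
  eta_moment : ∃ C : ℝ, ∀ t, ∀ᵐ ω ∂μ, (μ[fun ω => M.eta t ω ^ 4 | M.sigmaSX t]) ω ≤ C
  isUnit_SigmaS : ∀ t, IsUnit (M.SigmaS μ t)

/-- The behavior policy converges to the stationary policy `pibar`:
`π_t(a) - pibar(a | X_t) → 0` in probability, for every action `a`. -/
def PolicyConverges {mΩ : MeasurableSpace Ω} (M : Model d K Ω) (μ : Measure Ω)
    (pibar : StationaryPolicy d K) : Prop :=
  ∀ a, TendstoInMeasure μ (fun t ω => M.selProb t a ω - pibar.prob (M.X t ω) a) atTop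
    (fun _ => 0)

/-- Minimum sampling probability, for every action. -/
def MinSamplingProb {mΩ : MeasurableSpace Ω} (M : Model d K Ω) (μ : Measure Ω) : Prop :=
  ∃ pmin ∈ Set.Ioo (0 : ℝ) 1, ∀ t a, ∀ᵐ ω ∂μ, pmin ≤ M.selProb t a ω

/-- The inverse probability weight `1_{A_t = a} / π_t(A_t)`. -/
def weight (M : Model d K Ω) (a : Fin K) (t : ℕ) (ω : Ω) : ℝ :=
  (if M.A t ω = a then 1 else 0) / M.selProb t (M.A t ω) ω

/-- The bias-corrected score `g(x, y; θ) = x y - (x xᵀ - Σ_e) θ`. -/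
def score (M : Model d K Ω) (x : Vec d) (y : ℝ) (θ : Vec d) : Vec d :=
  y • x - WithLp.toLp 2 ((outer x - M.SigmaE) *ᵥ θ.ofLp)

/-- `G_{a,T}(θ) = (1/T) ∑_{t < T} 1_{A_t = a} / π_t(A_t) g(X_t, Y_t; θ)`. -/
def G (M : Model d K Ω) (a : Fin K) (T : ℕ) (θ : Vec d) (ω : Ω) : Vec d :=
  (1 / (T : ℝ)) • ∑ t ∈ Finset.range T, M.weight a t ω • M.score (M.X t ω) (M.Y t ω) θ

/-- `(1/T) ∑_{t < T} 1_{A_t = a} / π_t(A_t) (X_t X_tᵀ - Σ_e)`. -/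
def Gdot (M : Model d K Ω) (a : Fin K) (T : ℕ) (ω : Ω) : Matrix (Fin d) (Fin d) ℝ :=
  (1 / (T : ℝ)) • ∑ t ∈ Finset.range T, M.weight a t ω • (outer (M.X t ω) - M.SigmaE)

/-- The bias-corrected IPW estimator
`[(1/T) ∑ 1_{A_t = a} / π_t(A_t) (X_t X_tᵀ - Σ_e)]⁻¹ [(1/T) ∑ 1_{A_t = a} / π_t(A_t) X_t Y_t]`
(the inverse of a singular matrix being `0`). -/
def ipwEstimator (M : Model d K Ω) (T : ℕ) (a : Fin K) (ω : Ω) : Vec d :=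
  WithLp.toLp 2 ((M.Gdot a T ω)⁻¹ *ᵥ
    ((1 / (T : ℝ)) • ∑ t ∈ Finset.range T,
      M.weight a t ω • (M.Y t ω • (M.X t ω).ofLp)))

/-- A sequence of random vectors `(est T a)_a` solving, for every arm `a`, the estimating equation
`G_{a,T}(est T a) = o_p(1/√T)`. -/
structure IsIPWZEstimator {mΩ : MeasurableSpace Ω} (M : Model d K Ω) (μ : Measure Ω)
    (est : ℕ → Fin K → Ω → Vec d) : Prop where
  aemeasurable : ∀ T a, AEMeasurable (est T a) μ
  estimating_equation : ∀ a,
    TendstoInMeasure μ (fun (T : ℕ) ω => √(T : ℝ) • M.G a T (est T a ω) ω) atTop (fun _ => 0)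

/-- The stacked, rescaled error `√T (est T - θ^*)`, with coordinates indexed by
(coordinate, arm). -/
def stackedError (M : Model d K Ω) (est : ℕ → Fin K → Ω → Vec d) (T : ℕ) (ω : Ω) :
    EuclideanSpace ℝ (Fin d × Fin K) :=
  WithLp.toLp 2 fun p => √(T : ℝ) * (est T p.2 ω p.1 - M.theta p.2 p.1)

/-- `h_a(x, s) = (x xᵀ - Σ_e) θ_a^* - x sᵀ θ_a^*`. -/
def h (M : Model d K Ω) (a : Fin K) (x s : Vec d) : Vec d :=
  WithLp.toLp 2 ((outer x - M.SigmaE) *ᵥ (M.theta a).ofLp) - inner ℝ s (M.theta a) • x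

/-- `σ_η² = Var(η_t | S_t, X_t)`, a function of `(S_t, X_t)` that need not be constant. -/
def sigmaEtaSq {mΩ : MeasurableSpace Ω} (M : Model d K Ω) (μ : Measure Ω) (t : ℕ) : Ω → ℝ :=
  Var[M.eta t; μ | M.sigmaSX t]

/-- `E [ 1 / pibar(a | X_t) (h_a(X_t, S_t) h_a(X_t, S_t)ᵀ + σ_η² X_t X_tᵀ) ]`. -/
def Ibar {mΩ : MeasurableSpace Ω} (M : Model d K Ω) (μ : Measure Ω)
    (pibar : StationaryPolicy d K) (t : ℕ) (a : Fin K) : Matrix (Fin d) (Fin d) ℝ :=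
  Matrix.of fun i j => ∫ ω, 1 / pibar.prob (M.X t ω) a *
    (outer (M.h a (M.X t ω) (M.S t ω)) i j
      + M.sigmaEtaSq μ t ω * outer (M.X t ω) i j) ∂μ

/-- The asymptotic variance `Σ_a^* = Σ_S⁻¹ Ibar_a Σ_S⁻¹` of arm `a`. -/
def SigmaStar {mΩ : MeasurableSpace Ω} (M : Model d K Ω) (μ : Measure Ω)
    (pibar : StationaryPolicy d K) (t : ℕ) (a : Fin K) : Matrix (Fin d) (Fin d) ℝ :=
  (M.SigmaS μ t)⁻¹ * M.Ibar μ pibar t a * (M.SigmaS μ t)⁻¹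

/-- `(1/T) ∑_{t < T} 1_{A_t = a} / π_t(A_t)² [(X_t X_tᵀ - Σ_e) est - X_t Y_t]^{⊗ 2}`. -/
def Ihat (M : Model d K Ω) (est : ℕ → Fin K → Ω → Vec d) (a : Fin K) (T : ℕ) (ω : Ω) :
    Matrix (Fin d) (Fin d) ℝ :=
  (1 / (T : ℝ)) • ∑ t ∈ Finset.range T,
    ((if M.A t ω = a then 1 else 0) / M.selProb t (M.A t ω) ω ^ 2) •
      outer (WithLp.toLp 2 ((outer (M.X t ω) - M.SigmaE) *ᵥ (est T a ω).ofLp)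
        - M.Y t ω • M.X t ω)

/-- The plug-in variance estimator `Gdot⁻¹ Ihat (Gdot⁻¹)ᵀ`. -/
def SigmaHat (M : Model d K Ω) (est : ℕ → Fin K → Ω → Vec d) (a : Fin K) (T : ℕ) (ω : Ω) :
    Matrix (Fin d) (Fin d) ℝ :=
  (M.Gdot a T ω)⁻¹ * M.Ihat est a T ω * ((M.Gdot a T ω)⁻¹)ᵀ

end Model

end NoisyBandit

end

/-! The estimating function G_{a,T}(θ) is affine in θ with slope −`Gdot`, so no Taylor remainder
appears: wherever `Gdot` is invertible, est − θ* = Gdot⁻¹ (G(θ*) − G(est)) exactly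
(`sub_eq_inv_mulVec`). By hypothesis √T G(est) → 0 in probability. It remains to show that `Gdot`
tends to Σ_S in probability and that the stacked √T G(θ*) is asymptotically Gaussian with covariance
diag(Ibar_a); Slutsky's theorem then gives the limit law. Singular `Gdot` occurs with vanishing
probability and may be ignored.

The probabilistic core is `integral_history_mul_weight`. For W a function of the history, E[W ·
w_{a,t} f(X_t, Y_t)] = E[W] · E[f(X, Y(a))], because averaging over the action cancels 1/π_t and the
environment's draw is independent of the past. With W a centred term of an earlier round, it makes
centred weighted terms orthogonal, hence a weak law of large numbers. With W the exponential of the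
past sum, it supplies the conditions of a martingale central limit theorem, proved by a recursion
for characteristic functions.

Conditional variances contain w² = w/π_t, whose extra factor 1/π_t depends on the past. Replacing it
by 1/pibar costs an error that vanishes in L¹, by bounded convergence and the lower bound pmin.
Weights of distinct arms have product zero, so the limiting covariance is block diagonal.

Measurement error enters only through moments: E[X Xᵀ] − Σ_e = Σ_S = E[X Sᵀ], which identifies the
limit of `Gdot` and centres the score at θ*. Consistency of the variance estimator follows by
expanding the score, again exactly, around θ*.

Moments are written at an arbitrary reference round r. The quantities actually used are moments of
(X, Y(a)), whose law is the same in every round. -/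

noncomputable section

namespace NoisyBandit

/-! ### Convergence in probability to constants -/

section ConvergenceInMeasure

variable {Ω ι E F : Type*} {mΩ : MeasurableSpace Ω} {μ : Measure Ω} {l : Filter ι}

theorem tendsto_measure_of_subset {A B : ι → Set Ω} (hAB : ∀ n, A n ⊆ B n)
    (hB : Tendsto (fun n => μ (B n)) l (𝓝 0)) : Tendsto (fun n => μ (A n)) l (𝓝 0) :=
  tendsto_of_tendsto_of_tendsto_of_le_of_le tendsto_const_nhds hB (fun _ => zero_le)
    fun n => measure_mono (hAB n)

/-- The formulation by neighbourhoods makes continuous mapping at the limit point immediate, with no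
measurability or global continuity of the map. -/
theorem tendstoInMeasure_const_iff [PseudoEMetricSpace E] {X : ι → Ω → E} {c : E} :
    TendstoInMeasure μ X l (fun _ => c) ↔
      ∀ s ∈ 𝓝 c, Tendsto (fun n => μ {ω | X n ω ∉ s}) l (𝓝 0) := by
  constructor
  · intro h s hs
    obtain ⟨ε, hε, hsub⟩ := EMetric.mem_nhds_iff.1 hs
    refine tendsto_measure_of_subset (fun n ω hω => ?_) (h ε hε)
    by_contra hlt
    exact hω (hsub (by simpa using hlt))
  · intro h ε hε
    refine tendsto_measure_of_subset (fun n ω hω => ?_) (h _ (Metric.eball_mem_nhds c hε))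
    simpa using hω

theorem _root_.MeasureTheory.TendstoInMeasure.comp_continuousAt [PseudoEMetricSpace E]
    [PseudoEMetricSpace F] {X : ι → Ω → E} {c : E} (h : TendstoInMeasure μ X l (fun _ => c)) {g : E → F}
    (hg : ContinuousAt g c) :
    TendstoInMeasure μ (fun n ω => g (X n ω)) l (fun _ => g c) := by
  rw [tendstoInMeasure_const_iff] at h ⊢
  exact fun s hs => h _ (hg hs)

theorem _root_.MeasureTheory.TendstoInMeasure.pi {κ : Type*} [Fintype κ] {G : κ → Type*}
    [∀ k, PseudoEMetricSpace (G k)]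
    {X : ι → Ω → ∀ k, G k} {c : ∀ k, G k}
    (h : ∀ k, TendstoInMeasure μ (fun n ω => X n ω k) l (fun _ => c k)) :
    TendstoInMeasure μ X l (fun _ => c) := by
  intro ε hε
  have hsum : Tendsto (fun n => ∑ k, μ {ω | ε ≤ edist (X n ω k) (c k)}) l (𝓝 0) := by
    simpa using tendsto_finsetSum Finset.univ fun k _ => h k ε hε
  refine tendsto_of_tendsto_of_tendsto_of_le_of_le tendsto_const_nhds hsum
    (fun _ => zero_le) fun n => ?_
  refine (measure_mono fun ω hω => ?_).trans (measure_iUnion_fintype_le μ _)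
  by_contra hne
  simp only [Set.mem_iUnion, Set.mem_ofPred_eq, not_exists, not_le] at hne
  have : edist (X n ω) c < ε := by
    rw [edist_pi_def, Finset.sup_lt_iff (by simpa using hε)]
    exact fun k _ => hne k
  exact absurd hω (not_le.2 this)

theorem _root_.MeasureTheory.TendstoInMeasure.prodMk_const [PseudoEMetricSpace E]
    [PseudoEMetricSpace F] {X : ι → Ω → E} {Y : ι → Ω → F} {c : E} {d : F}
    (hX : TendstoInMeasure μ X l (fun _ => c)) (hY : TendstoInMeasure μ Y l (fun _ => d)) :
    TendstoInMeasure μ (fun n ω => (X n ω, Y n ω)) l (fun _ => (c, d)) := by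
  intro ε hε
  have hsum := (hX ε hε).add (hY ε hε)
  rw [add_zero] at hsum
  refine tendsto_of_tendsto_of_tendsto_of_le_of_le tendsto_const_nhds hsum
    (fun _ => zero_le) fun n => ?_
  refine (measure_mono fun ω hω => ?_).trans (measure_union_le _ _)
  simpa [Prod.edist_eq, le_max_iff] using hω

/-- This allows exceptional events of vanishing probability to be discarded; it is applied with the
event that some `Gdot` is singular. -/
theorem _root_.MeasureTheory.TendstoInMeasure.congr_of_measure_ne [PseudoEMetricSpace E]
    {X Y : ι → Ω → E} {c : E} (hX : TendstoInMeasure μ X l (fun _ => c)) {B : ι → Set Ω}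
    (hB : Tendsto (fun n => μ (B n)) l (𝓝 0)) (hXY : ∀ n ω, ω ∉ B n → X n ω = Y n ω) :
    TendstoInMeasure μ Y l (fun _ => c) := by
  intro ε hε
  have hsum := (hX ε hε).add hB
  rw [add_zero] at hsum
  refine tendsto_of_tendsto_of_tendsto_of_le_of_le tendsto_const_nhds hsum
    (fun _ => zero_le) fun n => ?_
  refine (measure_mono fun ω hω => ?_).trans (measure_union_le _ _)
  by_cases h : ω ∈ B n
  · exact Or.inr h
  · left
    simpa [hXY n ω h] using hω

theorem tendstoInMeasure_const [PseudoEMetricSpace E] (c : E) :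
    TendstoInMeasure μ (fun (_ : ι) (_ : Ω) => c) l (fun _ => c) := by
  intro ε hε
  simpa [not_le.2 hε] using tendsto_const_nhds

theorem _root_.MeasureTheory.TendstoInMeasure.mul_of_const
    {X Y : ι → Ω → ℝ} {a b : ℝ} (hX : TendstoInMeasure μ X l (fun _ => a))
    (hY : TendstoInMeasure μ Y l (fun _ => b)) :
    TendstoInMeasure μ (fun n ω => X n ω * Y n ω) l (fun _ => a * b) := by
  have h := TendstoInMeasure.comp_continuousAt (TendstoInMeasure.prodMk_const hX hY)
    (g := fun q : ℝ × ℝ => q.1 * q.2) (by fun_prop : Continuous fun q : ℝ × ℝ => _).continuousAt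
  exact h

theorem _root_.MeasureTheory.TendstoInMeasure.sub_of_const
    {X Y : ι → Ω → ℝ} {a b : ℝ} (hX : TendstoInMeasure μ X l (fun _ => a))
    (hY : TendstoInMeasure μ Y l (fun _ => b)) :
    TendstoInMeasure μ (fun n ω => X n ω - Y n ω) l (fun _ => a - b) := by
  have h := TendstoInMeasure.comp_continuousAt (TendstoInMeasure.prodMk_const hX hY)
    (g := fun q : ℝ × ℝ => q.1 - q.2) (by fun_prop : Continuous fun q : ℝ × ℝ => _).continuousAt
  exact h

theorem _root_.MeasureTheory.TendstoInMeasure.sum_of_const {κ : Type*} [Fintype κ]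
    {X : κ → ι → Ω → ℝ} {a : κ → ℝ}
    (hX : ∀ k, TendstoInMeasure μ (X k) l (fun _ => a k)) :
    TendstoInMeasure μ (fun n ω => ∑ k, X k n ω) l (fun _ => ∑ k, a k) := by
  have hpi : TendstoInMeasure μ (fun n ω k => X k n ω) l (fun _ k => a k) :=
    TendstoInMeasure.pi hX
  have h := TendstoInMeasure.comp_continuousAt hpi
    (g := fun q : κ → ℝ => ∑ k, q k) (by fun_prop : Continuous fun q : κ → ℝ => _).continuousAt
  exact h

theorem tendstoInMeasure_of_integral_abs {X : ι → Ω → ℝ} [IsFiniteMeasure μ]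
    (hint : ∀ n, Integrable (X n) μ)
    (h : Tendsto (fun n => ∫ ω, |X n ω| ∂μ) l (𝓝 0)) :
    TendstoInMeasure μ X l (fun _ => 0) := by
  rw [tendstoInMeasure_iff_measureReal_norm]
  intro ε hε
  have h2 : Tendsto (fun n => ε⁻¹ * ∫ ω, |X n ω| ∂μ) l (𝓝 0) := by simpa using h.const_mul ε⁻¹
  refine tendsto_of_tendsto_of_tendsto_of_le_of_le tendsto_const_nhds h2
    (fun _ => measureReal_nonneg) fun n => ?_
  have := mul_meas_ge_le_integral_of_nonneg (μ := μ) (f := fun ω => |X n ω|)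
    (ae_of_all _ fun _ => abs_nonneg _) (hint n).abs ε
  simp only [sub_zero, Real.norm_eq_abs]
  rw [inv_mul_eq_div, le_div_iff₀ hε]
  linarith

/-- Markov's inequality is applied to X², and continuity of the square root at 0 then transfers the
convergence to |X|. -/
theorem tendstoInMeasure_of_integral_sq {X : ι → Ω → ℝ} [IsFiniteMeasure μ]
    (hint : ∀ n, Integrable (fun ω => X n ω ^ 2) μ)
    (h : Tendsto (fun n => ∫ ω, X n ω ^ 2 ∂μ) l (𝓝 0)) :
    TendstoInMeasure μ X l (fun _ => 0) := by
  have h1 := tendstoInMeasure_of_integral_abs hint (by simpa using h)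
  have h2 := TendstoInMeasure.comp_continuousAt h1 (Real.continuous_sqrt.continuousAt)
  rw [tendstoInMeasure_iff_norm] at h2 ⊢
  simpa [Real.sqrt_sq_eq_abs] using h2

/-- Bounded convergence: convergence in measure to zero of a bounded sequence implies
convergence in mean. -/
theorem tendsto_integral_abs_of_tendstoInMeasure [IsProbabilityMeasure μ] {X : ι → Ω → ℝ} {C : ℝ}
    (hint : ∀ n, AEMeasurable (X n) μ) (hbd : ∀ n, ∀ᵐ ω ∂μ, |X n ω| ≤ C)
    (h : TendstoInMeasure μ X l (fun _ => 0)) :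
    Tendsto (fun n => ∫ ω, |X n ω| ∂μ) l (𝓝 0) := by
  rw [tendstoInMeasure_iff_measureReal_norm] at h
  simp only [sub_zero, Real.norm_eq_abs] at h
  -- |X| is at most ε below the level ε and at most C above it.
  have key : ∀ ε > 0, ∀ n, ∫ ω, |X n ω| ∂μ ≤ ε + C * μ.real {ω | ε ≤ |X n ω|} := by
    intro ε hε n
    have hset : NullMeasurableSet {ω | ε ≤ |X n ω|} μ :=
      nullMeasurableSet_le aemeasurable_const (hint n).abs
    have hle : ∀ᵐ ω ∂μ, |X n ω| ≤ ε + {ω | ε ≤ |X n ω|}.indicator (fun _ => C) ω := by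
      filter_upwards [hbd n] with ω hω
      by_cases hh : ε ≤ |X n ω|
      · rw [Set.indicator_of_mem (by exact hh)]
        linarith
      · rw [Set.indicator_of_notMem (by exact hh)]
        linarith [not_le.1 hh]
    have hi1 : Integrable (fun ω => {ω | ε ≤ |X n ω|}.indicator (fun _ => C) ω) μ :=
      (integrable_const C).indicator₀ hset
    calc ∫ ω, |X n ω| ∂μ ≤ ∫ ω, (ε + {ω | ε ≤ |X n ω|}.indicator (fun _ => C) ω) ∂μ := by
          refine integral_mono_ae ?_ ((integrable_const _).add hi1) hle
          exact Integrable.of_bound (hint n).abs.aestronglyMeasurable C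
            (by filter_upwards [hbd n] with ω hω; simpa using hω)
      _ = ε + C * μ.real {ω | ε ≤ |X n ω|} := by
          rw [integral_add (integrable_const _) hi1, integral_indicator₀ hset]
          simp [mul_comm]
  rw [Metric.tendsto_nhds]
  intro ε hε
  have h1 : Tendsto (fun n => ε / 2 + C * μ.real {ω | ε / 2 ≤ |X n ω|}) l (𝓝 (ε / 2)) := by
    simpa using ((h (ε / 2) (by positivity)).const_mul C).const_add (ε / 2)
  filter_upwards [h1.eventually_lt_const (half_lt_self hε)] with n hn
  rw [Real.dist_eq, sub_zero, abs_of_nonneg (integral_nonneg fun _ => abs_nonneg _)]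
  exact (key _ (by positivity) n).trans_lt hn

end ConvergenceInMeasure

/-! ### Weak law for orthogonal sequences -/

section Averages

variable {Ω : Type*} {mΩ : MeasurableSpace Ω} {μ : Measure Ω}

/-- Cross terms integrate to zero, so second moments add. -/
theorem integral_sum_sq_le_of_orthogonal {D : ℕ → Ω → ℝ} (hD : ∀ t, MemLp (D t) 2 μ) {C : ℝ}
    (hC : ∀ t, ∫ ω, D t ω ^ 2 ∂μ ≤ C) (horth : ∀ s t, s < t → ∫ ω, D s ω * D t ω ∂μ = 0) (T : ℕ) :
    ∫ ω, (∑ t ∈ Finset.range T, D t ω) ^ 2 ∂μ ≤ T * C := by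
  induction T with
  | zero => simp
  | succ T ih =>
    have hS : MemLp (fun ω => ∑ t ∈ Finset.range T, D t ω) 2 μ := memLp_finsetSum _ fun t _ => hD t
    have hcross : ∫ ω, (∑ t ∈ Finset.range T, D t ω) * D T ω ∂μ = 0 := by
      simp_rw [Finset.sum_mul]
      rw [integral_finsetSum _ fun t _ => show Integrable (fun ω => D t ω * D T ω) μ from
        (hD t).integrable_mul (hD T)]
      exact Finset.sum_eq_zero fun t ht => horth t T (Finset.mem_range.1 ht)
    have hexp : ∀ ω, (∑ t ∈ Finset.range (T + 1), D t ω) ^ 2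
        = (∑ t ∈ Finset.range T, D t ω) ^ 2
          + (2 * ((∑ t ∈ Finset.range T, D t ω) * D T ω) + D T ω ^ 2) := by
      intro ω
      rw [Finset.sum_range_succ]
      ring
    have hi : Integrable (fun ω => (∑ t ∈ Finset.range T, D t ω) * D T ω) μ :=
      hS.integrable_mul (hD T)
    have hi2 : Integrable (fun ω => 2 * ((∑ t ∈ Finset.range T, D t ω) * D T ω) + D T ω ^ 2) μ :=
      (hi.const_mul 2).add (hD T).integrable_sq
    simp_rw [hexp]
    rw [integral_add hS.integrable_sq hi2, integral_add (hi.const_mul 2) (hD T).integrable_sq, integral_const_mul, hcross]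
    push_cast
    linarith [hC T]

/-- Weak law of large numbers for orthogonal sequences bounded in `L²`. -/
theorem tendstoInMeasure_average_of_orthogonal [IsFiniteMeasure μ] {D : ℕ → Ω → ℝ} (hD : ∀ t, MemLp (D t) 2 μ) {C : ℝ}
    (hC : ∀ t, ∫ ω, D t ω ^ 2 ∂μ ≤ C) (horth : ∀ s t, s < t → ∫ ω, D s ω * D t ω ∂μ = 0) :
    TendstoInMeasure μ (fun (T : ℕ) ω => (1 / (T : ℝ)) * ∑ t ∈ Finset.range T, D t ω) atTop
      (fun _ => 0) := by
  have hS : ∀ T : ℕ, MemLp (fun ω => ∑ t ∈ Finset.range T, D t ω) 2 μ :=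
    fun T => memLp_finsetSum _ fun t _ => hD t
  refine tendstoInMeasure_of_integral_sq (fun T => ?_) ?_
  · simp_rw [mul_pow]
    exact (hS T).integrable_sq.const_mul _
  · have hlim : Tendsto (fun T : ℕ => C / (T : ℝ)) atTop (𝓝 0) :=
      tendsto_const_div_atTop_nhds_zero_nat C
    refine tendsto_of_tendsto_of_tendsto_of_le_of_le' tendsto_const_nhds hlim
      (Eventually.of_forall fun T => integral_nonneg fun _ => sq_nonneg _) ?_
    filter_upwards [eventually_gt_atTop 0] with T hT
    simp_rw [mul_pow]
    rw [integral_const_mul]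
    have hT' : (0 : ℝ) < T := by exact_mod_cast hT
    calc (1 / (T : ℝ)) ^ 2 * ∫ ω, (∑ t ∈ Finset.range T, D t ω) ^ 2 ∂μ
        ≤ (1 / (T : ℝ)) ^ 2 * (T * C) := by
          gcongr
          exact integral_sum_sq_le_of_orthogonal hD hC horth T
      _ = C / T := by field_simp

end Averages

/-! ### Martingale central limit theorem by characteristic functions -/

section CentralLimit

/-- For |x| ≤ 1 this is the exponential series bound; for |x| > 1 the triangle inequality gives 2 +
|x| + x²/2, and every term is dominated by a multiple of |x|³. The constant 4 is not optimal. -/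
theorem norm_exp_mul_I_sub_le (x : ℝ) :
    ‖Complex.exp (x * Complex.I) - (1 + x * Complex.I - x ^ 2 / 2)‖ ≤ 4 * |x| ^ 3 := by
  rcases le_or_gt |x| 1 with h | h
  · have hb := Complex.exp_bound (x := x * Complex.I) (by simpa using h) (n := 3) (by norm_num)
    have hs : ∑ m ∈ Finset.range 3, ((x : ℂ) * Complex.I) ^ m / (m.factorial : ℂ)
        = 1 + x * Complex.I - x ^ 2 / 2 := by
      simp only [Finset.sum_range_succ, Finset.sum_range_zero, Nat.factorial, mul_pow,
        Complex.I_sq]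
      push_cast
      ring
    rw [hs] at hb
    refine hb.trans ?_
    have : (0 : ℝ) ≤ |x| ^ 3 := by positivity
    simp only [norm_mul, Complex.norm_real, Complex.norm_I, mul_one, Real.norm_eq_abs,
      Nat.factorial]
    norm_num
    linarith
  · have h1 : ‖Complex.exp (x * Complex.I) - (1 + x * Complex.I - x ^ 2 / 2)‖
        ≤ 1 + (1 + |x| + |x| ^ 2 / 2) := by
      refine (norm_sub_le _ _).trans ?_
      rw [Complex.norm_exp_ofReal_mul_I]
      gcongr
      refine (norm_sub_le _ _).trans ?_
      gcongr
      · refine (norm_add_le _ _).trans ?_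
        simp
      · simp
    have h2 : |x| ≤ |x| ^ 3 := by nlinarith [sq_nonneg |x|, mul_self_nonneg (|x| - 1)]
    have h3 : |x| ^ 2 ≤ |x| ^ 3 := by nlinarith [sq_nonneg |x|]
    linarith

variable {Ω : Type*} {mΩ : MeasurableSpace Ω} {μ : Measure Ω} [IsProbabilityMeasure μ]

/-- Expand exp(ivξ) to second order inside E[exp(ivS) exp(ivξ)]. The linear term vanishes by `h1`,
the quadratic one is −v²σ²/2 times the old characteristic function up to v²δ/2, and the remainder is
controlled by the third moment. -/
theorem norm_integral_exp_step {S ξ : Ω → ℝ} (hS : Measurable S) (hξ : Measurable ξ)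
    (hL : MemLp ξ 3 μ) {C σ2 δ v : ℝ} (hC : ∫ ω, |ξ ω| ^ 3 ∂μ ≤ C)
    (h1 : ∫ ω, Complex.exp ((v * S ω : ℝ) * Complex.I) * (ξ ω : ℂ) ∂μ = 0)
    (h2 : ‖∫ ω, Complex.exp ((v * S ω : ℝ) * Complex.I) * ((ξ ω ^ 2 : ℝ) : ℂ) ∂μ
      - σ2 * ∫ ω, Complex.exp ((v * S ω : ℝ) * Complex.I) ∂μ‖ ≤ δ) :
    ‖∫ ω, Complex.exp ((v * (S ω + ξ ω) : ℝ) * Complex.I) ∂μ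
      - (1 - v ^ 2 * σ2 / 2 : ℝ) * ∫ ω, Complex.exp ((v * S ω : ℝ) * Complex.I) ∂μ‖
      ≤ v ^ 2 / 2 * δ + 4 * |v| ^ 3 * C := by
  have hL1 : Integrable ξ μ := hL.integrable (by norm_num)
  have hL2 : Integrable (fun ω => ξ ω ^ 2) μ := (hL.mono_exponent (by norm_num)).integrable_sq
  have hL3 : Integrable (fun ω => |ξ ω| ^ 3) μ := by
    simpa using hL.integrable_norm_pow (p := 3) (by norm_num)
  set e : Ω → ℂ := fun ω => Complex.exp ((v * S ω : ℝ) * Complex.I) with he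
  have hem : AEStronglyMeasurable e μ := by
    apply Measurable.aestronglyMeasurable
    fun_prop
  have hen : ∀ ω, ‖e ω‖ = 1 := fun ω => Complex.norm_exp_ofReal_mul_I _
  have hei : Integrable e μ := Integrable.of_bound hem 1 (ae_of_all _ fun ω => (hen ω).le)
  have hi1 : Integrable (fun ω => e ω * (ξ ω : ℂ)) μ :=
    hL1.ofReal.bdd_mul hem (ae_of_all _ fun ω => (hen ω).le)
  have hi2 : Integrable (fun ω => e ω * ((ξ ω ^ 2 : ℝ) : ℂ)) μ :=
    hL2.ofReal.bdd_mul hem (ae_of_all _ fun ω => (hen ω).le)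
  let R : Ω → ℂ := fun ω => e ω * (Complex.exp ((v * ξ ω : ℝ) * Complex.I)
    - (1 + (v * ξ ω : ℝ) * Complex.I - ((v * ξ ω : ℝ) : ℂ) ^ 2 / 2))
  have hRb : ∀ ω, ‖R ω‖ ≤ 4 * |v| ^ 3 * |ξ ω| ^ 3 := by
    intro ω
    rw [norm_mul, hen, one_mul]
    refine (norm_exp_mul_I_sub_le _).trans_eq ?_
    rw [abs_mul]
    ring
  have hRm : AEStronglyMeasurable R μ := by
    apply Measurable.aestronglyMeasurable
    fun_prop
  have hRi : Integrable R μ :=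
    (hL3.const_mul (4 * |v| ^ 3)).mono' hRm (ae_of_all _ hRb)
  have hdec : ∀ ω, Complex.exp ((v * (S ω + ξ ω) : ℝ) * Complex.I)
      = e ω + ((v : ℂ) * Complex.I) * (e ω * (ξ ω : ℂ))
        - ((v : ℂ) ^ 2 / 2) * (e ω * ((ξ ω ^ 2 : ℝ) : ℂ)) + R ω := by
    intro ω
    have : Complex.exp ((v * (S ω + ξ ω) : ℝ) * Complex.I)
        = e ω * Complex.exp ((v * ξ ω : ℝ) * Complex.I) := by
      rw [he, ← Complex.exp_add]
      congr 1
      push_cast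
      ring
    rw [this]
    simp only [R]
    push_cast
    ring
  have hint : ∫ ω, Complex.exp ((v * (S ω + ξ ω) : ℝ) * Complex.I) ∂μ
      = ∫ ω, e ω ∂μ - ((v : ℂ) ^ 2 / 2) * ∫ ω, e ω * ((ξ ω ^ 2 : ℝ) : ℂ) ∂μ + ∫ ω, R ω ∂μ := by
    have hia : Integrable (fun ω => e ω + ((v : ℂ) * Complex.I) * (e ω * (ξ ω : ℂ))) μ :=
      hei.add (hi1.const_mul _)
    have hib : Integrable (fun ω => e ω + ((v : ℂ) * Complex.I) * (e ω * (ξ ω : ℂ))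
        - ((v : ℂ) ^ 2 / 2) * (e ω * ((ξ ω ^ 2 : ℝ) : ℂ))) μ := hia.sub (hi2.const_mul _)
    simp_rw [hdec]
    rw [integral_add hib hRi, integral_sub hia (hi2.const_mul _),
      integral_add hei (hi1.const_mul _), integral_const_mul, integral_const_mul, h1]
    ring
  have hRn : ‖∫ ω, R ω ∂μ‖ ≤ 4 * |v| ^ 3 * C := by
    calc ‖∫ ω, R ω ∂μ‖ ≤ ∫ ω, 4 * |v| ^ 3 * |ξ ω| ^ 3 ∂μ :=
          norm_integral_le_of_norm_le (hL3.const_mul _) (ae_of_all _ hRb)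
      _ ≤ 4 * |v| ^ 3 * C := by
          rw [integral_const_mul]
          gcongr
  rw [hint]
  have heq : ∫ ω, e ω ∂μ - ((v : ℂ) ^ 2 / 2) * ∫ ω, e ω * ((ξ ω ^ 2 : ℝ) : ℂ) ∂μ + ∫ ω, R ω ∂μ
      - (1 - v ^ 2 * σ2 / 2 : ℝ) * ∫ ω, e ω ∂μ
      = -((v : ℂ) ^ 2 / 2) * (∫ ω, e ω * ((ξ ω ^ 2 : ℝ) : ℂ) ∂μ - σ2 * ∫ ω, e ω ∂μ)
        + ∫ ω, R ω ∂μ := by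
    push_cast
    ring
  rw [heq]
  refine (norm_add_le _ _).trans (add_le_add ?_ hRn)
  rw [norm_mul, norm_neg]
  have : ‖(v : ℂ) ^ 2 / 2‖ = v ^ 2 / 2 := by simp
  rw [this]
  gcongr

/-- Martingale central limit theorem, in terms of characteristic functions: the increments are
conditionally centered and have asymptotically deterministic conditional variances, tested against
the exponentials of the partial sums. -/
theorem tendsto_integral_exp_of_martingale_difference {ξ : ℕ → Ω → ℝ}
    (hξ : ∀ t, Measurable (ξ t)) (hL : ∀ t, MemLp (ξ t) 3 μ) {C σ2 : ℝ} (hσ : 0 ≤ σ2)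
    (hC : ∀ t, ∫ ω, |ξ t ω| ^ 3 ∂μ ≤ C) {δ : ℕ → ℝ} (hδ : Tendsto δ atTop (𝓝 0))
    (h1 : ∀ (v : ℝ) t, ∫ ω, Complex.exp ((v * ∑ s ∈ Finset.range t, ξ s ω : ℝ) * Complex.I)
      * (ξ t ω : ℂ) ∂μ = 0)
    (h2 : ∀ (v : ℝ) t, ‖∫ ω, Complex.exp ((v * ∑ s ∈ Finset.range t, ξ s ω : ℝ) * Complex.I)
        * ((ξ t ω ^ 2 : ℝ) : ℂ) ∂μ
      - σ2 * ∫ ω, Complex.exp ((v * ∑ s ∈ Finset.range t, ξ s ω : ℝ) * Complex.I) ∂μ‖ ≤ δ t) :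
    Tendsto (fun T : ℕ => ∫ ω, Complex.exp
        (((1 / √(T : ℝ)) * ∑ s ∈ Finset.range T, ξ s ω : ℝ) * Complex.I) ∂μ) atTop
      (𝓝 (Complex.exp (-(σ2 : ℂ) / 2))) := by
  set φ : ℝ → ℕ → ℂ := fun v t =>
    ∫ ω, Complex.exp ((v * ∑ s ∈ Finset.range t, ξ s ω : ℝ) * Complex.I) ∂μ with hφ
  have hstep : ∀ v t, ‖φ v (t + 1) - (1 - v ^ 2 * σ2 / 2 : ℝ) * φ v t‖
      ≤ v ^ 2 / 2 * δ t + 4 * |v| ^ 3 * C := by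
    intro v t
    have := norm_integral_exp_step (μ := μ) (S := fun ω => ∑ s ∈ Finset.range t, ξ s ω)
      (Finset.measurable_fun_sum _ fun s _ => hξ s) (hξ t) (hL t) (v := v) (hC t) (h1 v t)
      (h2 v t)
    simpa only [hφ, Finset.sum_range_succ] using this
  -- The condition on v keeps the factor 1 − v²σ²/2 in [0, 1], so the one-step errors add up without
  -- being amplified.
  have hmain : ∀ v : ℝ, v ^ 2 * σ2 / 2 ≤ 1 → ∀ T : ℕ,
      ‖φ v T - ((1 - v ^ 2 * σ2 / 2 : ℝ) : ℂ) ^ T‖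
      ≤ ∑ t ∈ Finset.range T, (v ^ 2 / 2 * δ t + 4 * |v| ^ 3 * C) := by
    intro v hv T
    induction T with
    | zero => simp [hφ]
    | succ T ih =>
      rw [Finset.sum_range_succ]
      have hq : ‖((1 - v ^ 2 * σ2 / 2 : ℝ) : ℂ)‖ ≤ 1 := by
        rw [Complex.norm_real, Real.norm_eq_abs, abs_le]
        have : 0 ≤ v ^ 2 * σ2 / 2 := by positivity
        constructor <;> linarith
      calc ‖φ v (T + 1) - ((1 - v ^ 2 * σ2 / 2 : ℝ) : ℂ) ^ (T + 1)‖
          = ‖((1 - v ^ 2 * σ2 / 2 : ℝ) : ℂ) * (φ v T - ((1 - v ^ 2 * σ2 / 2 : ℝ) : ℂ) ^ T)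
            + (φ v (T + 1) - (1 - v ^ 2 * σ2 / 2 : ℝ) * φ v T)‖ := by
            congr 1
            ring
        _ ≤ 1 * ‖φ v T - ((1 - v ^ 2 * σ2 / 2 : ℝ) : ℂ) ^ T‖
            + (v ^ 2 / 2 * δ T + 4 * |v| ^ 3 * C) := by
            refine (norm_add_le _ _).trans (add_le_add ?_ (hstep v T))
            rw [norm_mul]
            gcongr
        _ ≤ _ := by linarith
  have hpow : Tendsto (fun T : ℕ => ((1 - (1 / √(T : ℝ)) ^ 2 * σ2 / 2 : ℝ) : ℂ) ^ T) atTop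
      (𝓝 (Complex.exp (-(σ2 : ℂ) / 2))) := by
    refine (Complex.tendsto_one_add_div_pow_exp (-(σ2 : ℂ) / 2)).congr fun T => ?_
    congr 1
    rw [div_pow, Real.sq_sqrt (Nat.cast_nonneg T)]
    push_cast
    ring
  -- At v = 1/√T the accumulated error is half the Cesàro mean of δ plus T · 4|v|³C = 4C/√T.
  have hbound : Tendsto (fun T : ℕ => 1 / 2 * ((T : ℝ)⁻¹ * ∑ t ∈ Finset.range T, δ t)
      + 4 * C * (1 / √(T : ℝ))) atTop (𝓝 0) := by
    have ha := (hδ.cesaro).const_mul (1 / 2 : ℝ)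
    have hb : Tendsto (fun T : ℕ => 4 * C * (1 / √(T : ℝ))) atTop (𝓝 (4 * C * 0)) := by
      refine Tendsto.const_mul _ ?_
      simp_rw [one_div]
      exact tendsto_inv_atTop_zero.comp
        (Real.tendsto_sqrt_atTop.comp tendsto_natCast_atTop_atTop)
    simpa using ha.add hb
  have hdiff : Tendsto (fun T : ℕ => φ (1 / √(T : ℝ)) T
      - ((1 - (1 / √(T : ℝ)) ^ 2 * σ2 / 2 : ℝ) : ℂ) ^ T) atTop (𝓝 0) := by
    refine squeeze_zero_norm' ?_ hbound
    -- For T > 0 this is the condition v²σ²/2 ≤ 1 of `hmain` at v = 1/√T.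
    have hev : ∀ᶠ T : ℕ in atTop, σ2 / 2 ≤ (T : ℝ) :=
      tendsto_natCast_atTop_atTop.eventually_ge_atTop _
    filter_upwards [hev, eventually_gt_atTop 0] with T hT hT0
    have hT0' : (0 : ℝ) < T := by exact_mod_cast hT0
    have hsq : (1 / √(T : ℝ)) ^ 2 = 1 / T := by
      rw [div_pow, Real.sq_sqrt hT0'.le, one_pow]
    have hcube : (T : ℝ) * |1 / √(T : ℝ)| ^ 3 = 1 / √(T : ℝ) := by
      rw [abs_of_nonneg (by positivity), pow_succ, hsq]
      field_simp
    refine (hmain _ ?_ T).trans_eq ?_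
    · rw [hsq, div_mul_eq_mul_div, one_mul, div_div, mul_comm, ← div_div, div_le_one hT0']
      exact hT
    · rw [Finset.sum_add_distrib, ← Finset.mul_sum, Finset.sum_const, Finset.card_range, hsq,
        nsmul_eq_mul]
      linear_combination (4 * C) * hcube
  have := hdiff.add hpow
  simp only [sub_add_cancel, zero_add] at this
  exact this

end CentralLimit

/-! ### Records, weights and measurability -/

namespace Model

variable {d K : ℕ} {Ω : Type*}

/-- What is recorded in round `t`. -/
def record (M : Model d K Ω) (t : ℕ) (ω : Ω) : Rec d K :=
  (M.X t ω, M.selProb t (M.A t ω) ω, M.A t ω, M.Y t ω)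

/-- The context and the potential outcome of arm `a` in round `t`. -/
def armPair (M : Model d K Ω) (a : Fin K) (t : ℕ) (ω : Ω) : Vec d × ℝ :=
  (M.X t ω, M.potentialOutcome t ω a)

/-- The context and the observed outcome in round `t`. -/
def obsPair (M : Model d K Ω) (t : ℕ) (ω : Ω) : Vec d × ℝ := (M.X t ω, M.Y t ω)

/-- The history is built by a `Fin.snoc` recursion. Reading off its entries exhibits quantities of
earlier rounds as measurable functions of the history, the form required of W below. -/
theorem history_apply (M : Model d K Ω) (t : ℕ) (ω : Ω) (s : Fin t) :
    M.history t ω s = M.record s ω := by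
  induction t with
  | zero => exact s.elim0
  | succ t ih =>
    refine Fin.lastCases ?_ (fun i => ?_) s
    · simp [history, record, selProb]
    · simpa [history] using ih i

theorem selProb_nonneg (M : Model d K Ω) (t : ℕ) (a : Fin K) (ω : Ω) : 0 ≤ M.selProb t a ω :=
  M.policy.prob_nonneg _ _ _ _

theorem selProb_le_one (M : Model d K Ω) (t : ℕ) (a : Fin K) (ω : Ω) : M.selProb t a ω ≤ 1 := by
  rw [← M.policy.sum_prob t (M.history t ω) (M.X t ω)]
  exact Finset.single_le_sum (fun b _ => M.policy.prob_nonneg t _ _ b) (Finset.mem_univ a)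

theorem weight_eq (M : Model d K Ω) (a : Fin K) (t : ℕ) (ω : Ω) :
    M.weight a t ω = if M.A t ω = a then 1 / M.selProb t a ω else 0 := by
  unfold weight
  split_ifs with h
  · rw [h]
  · simp

theorem weight_nonneg (M : Model d K Ω) (a : Fin K) (t : ℕ) (ω : Ω) : 0 ≤ M.weight a t ω := by
  rw [weight_eq]
  split_ifs
  · exact one_div_nonneg.2 (M.selProb_nonneg t a ω)
  · exact le_rfl

/-- The weight vanishes unless A_t = a, and on that event the observed outcome is the potential
outcome of arm a. -/
theorem weight_mul_obsPair {E : Type*} [AddCommGroup E] [Module ℝ E] (M : Model d K Ω) (a : Fin K)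
    (t : ℕ) (ω : Ω) (f : Vec d × ℝ → E) :
    M.weight a t ω • f (M.obsPair t ω) = M.weight a t ω • f (M.armPair a t ω) := by
  rw [weight_eq]
  split_ifs with h
  · simp only [obsPair, armPair, Y, h]
  · simp

/-- Only one arm is played per round; this is the source of the block diagonal limit. -/
theorem weight_mul_weight_of_ne (M : Model d K Ω) {a b : Fin K} (hab : a ≠ b) (t : ℕ) (ω : Ω) :
    M.weight a t ω * M.weight b t ω = 0 := by
  rw [weight_eq, weight_eq]
  split_ifs with h1 h2
  · exact absurd (h1.symm.trans h2) hab
  all_goals simp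

variable {mΩ : MeasurableSpace Ω} {μ : Measure Ω} {M : Model d K Ω}

namespace IsNoisyContextBandit

section Measurability

theorem measurable_potentialOutcome (hM : M.IsNoisyContextBandit μ) (t : ℕ) :
    Measurable (M.potentialOutcome t) := by
  refine measurable_pi_lambda _ fun a => ?_
  have := hM.measurable_S t
  have := hM.measurable_eta t
  unfold potentialOutcome
  fun_prop

theorem measurable_Y (hM : M.IsNoisyContextBandit μ) (t : ℕ) : Measurable (M.Y t) := by
  have h1 := hM.measurable_S t
  have h2 := hM.measurable_eta t
  have h3 : Measurable fun ω => M.theta (M.A t ω) :=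
    (Measurable.of_discrete (f := M.theta)).comp (hM.measurable_A t)
  exact (h1.inner h3).add h2

theorem measurable_selProb_of_history (hM : M.IsNoisyContextBandit μ) {t : ℕ}
    (ht : Measurable (M.history t)) (a : Fin K) : Measurable (M.selProb t a) :=
  (M.policy.measurable_prob t a).comp (ht.prodMk (hM.measurable_X t))

theorem measurable_record_of_history (hM : M.IsNoisyContextBandit μ) {t : ℕ}
    (ht : Measurable (M.history t)) : Measurable (M.record t) := by
  have h1 : Measurable fun ω => M.selProb t (M.A t ω) ω := by
    have : (fun ω => M.selProb t (M.A t ω) ω)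
        = fun ω => ∑ a, if M.A t ω = a then M.selProb t a ω else 0 := by
      ext ω
      simp
    rw [this]
    refine Finset.measurable_fun_sum _ fun a _ => Measurable.ite ?_
      (hM.measurable_selProb_of_history ht a) measurable_const
    exact hM.measurable_A t (measurableSet_singleton a)
  exact (hM.measurable_X t).prodMk (h1.prodMk ((hM.measurable_A t).prodMk (hM.measurable_Y t)))

theorem measurable_history (hM : M.IsNoisyContextBandit μ) (t : ℕ) :
    Measurable (M.history t) := by
  -- The record of round s involves π_s, hence the whole history before s.
  induction t using Nat.strong_induction_on with
  | _ t ih =>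
    refine measurable_pi_lambda _ fun s => ?_
    simp_rw [history_apply]
    exact hM.measurable_record_of_history (ih s s.2)

theorem measurable_selProb (hM : M.IsNoisyContextBandit μ) (t : ℕ) (a : Fin K) :
    Measurable (M.selProb t a) :=
  hM.measurable_selProb_of_history (hM.measurable_history t) a

theorem measurable_weight (hM : M.IsNoisyContextBandit μ) (a : Fin K) (t : ℕ) :
    Measurable (M.weight a t) := by
  have : M.weight a t = fun ω => if M.A t ω = a then 1 / M.selProb t a ω else 0 := by
    ext ω
    exact M.weight_eq a t ω
  rw [this]
  exact Measurable.ite (hM.measurable_A t (measurableSet_singleton a))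
    ((hM.measurable_selProb t a).const_div 1) measurable_const

theorem measurable_armPair (hM : M.IsNoisyContextBandit μ) (a : Fin K) (t : ℕ) :
    Measurable (M.armPair a t) :=
  (hM.measurable_X t).prodMk ((measurable_pi_apply a).comp (hM.measurable_potentialOutcome t))

theorem measurable_obsPair (hM : M.IsNoisyContextBandit μ) (t : ℕ) :
    Measurable (M.obsPair t) :=
  (hM.measurable_X t).prodMk (hM.measurable_Y t)

theorem identDistrib_armPair (hM : M.IsNoisyContextBandit μ) (a : Fin K) (s t : ℕ) :
    IdentDistrib (M.armPair a s) (M.armPair a t) μ μ :=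
  (hM.identDistrib s t).comp (u := fun q : Vec d × (Fin K → ℝ) => (q.1, q.2 a)) (by fun_prop)

theorem identDistrib_X (hM : M.IsNoisyContextBandit μ) (s t : ℕ) :
    IdentDistrib (M.X s) (M.X t) μ μ :=
  (hM.identDistrib s t).comp measurable_fst

theorem integral_armPair (hM : M.IsNoisyContextBandit μ) (a : Fin K) (s t : ℕ)
    {f : Vec d × ℝ → ℝ} (hf : Measurable f) :
    ∫ ω, f (M.armPair a s ω) ∂μ = ∫ ω, f (M.armPair a t ω) ∂μ :=
  ((hM.identDistrib_armPair a s t).comp hf).integral_eq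

theorem memLp_armPair (hM : M.IsNoisyContextBandit μ) (a : Fin K) {s : ℕ} (t : ℕ)
    {f : Vec d × ℝ → ℝ} (hf : Measurable f) {p : ENNReal}
    (h : MemLp (fun ω => f (M.armPair a s ω)) p μ) : MemLp (fun ω => f (M.armPair a t ω)) p μ :=
  ((hM.identDistrib_armPair a s t).comp hf).memLp_iff.1 h

end Measurability

/-! ### Inverse probability weighting and its law of large numbers -/

section InverseProbabilityWeighting

theorem weight_le {pmin : ℝ} (hp0 : 0 < pmin) (hpm : ∀ t a, ∀ᵐ ω ∂μ, pmin ≤ M.selProb t a ω) (a : Fin K)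
    (t : ℕ) : ∀ᵐ ω ∂μ, M.weight a t ω ≤ 1 / pmin := by
  filter_upwards [hpm t a] with ω hω
  rw [weight_eq]
  split_ifs
  · exact one_div_le_one_div_of_le hp0 hω
  · positivity

/-- The weight is bounded by 1/pmin. The moment assumption is placed at a fixed round r and carried
to round t by equality in law. -/
theorem memLp_weight_mul {pmin : ℝ} (hM : M.IsNoisyContextBandit μ) (hp0 : 0 < pmin)
    (hpm : ∀ t a, ∀ᵐ ω ∂μ, pmin ≤ M.selProb t a ω) {r : ℕ} (t : ℕ) (a : Fin K)
    {f : Vec d × ℝ → ℝ} (hf : Measurable f) {p : ENNReal}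
    (h : MemLp (fun ω => f (M.armPair a r ω)) p μ) :
    MemLp (fun ω => M.weight a t ω * f (M.obsPair t ω)) p μ := by
  refine (hM.memLp_armPair a t hf h).of_le_mul (c := 1 / pmin)
    ((hM.measurable_weight a t).mul (hf.comp (hM.measurable_obsPair t))).aestronglyMeasurable ?_
  filter_upwards [weight_le hp0 hpm a t] with ω hω
  have := M.weight_mul_obsPair a t ω f
  simp only [smul_eq_mul] at this
  rw [this, norm_mul, Real.norm_of_nonneg (M.weight_nonneg a t ω)]
  gcongr

variable [IsProbabilityMeasure μ]

/-- Condition on history and context: the first event is measurable there, unconfoundedness splits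
the other two, and the conditional probability of the action is π_t. Since π_t is also measurable
there, the conditioning can be undone. -/
theorem measureReal_action_inter (hM : M.IsNoisyContextBandit μ) (t : ℕ) (a : Fin K)
    {B : Set ((Fin t → Rec d K) × Vec d)} (hB : MeasurableSet B) {C : Set (Fin K → ℝ)}
    (hC : MeasurableSet C) :
    μ.real (M.A t ⁻¹' {a} ∩ ((fun ω => (M.history t ω, M.X t ω)) ⁻¹' B
        ∩ M.potentialOutcome t ⁻¹' C))
      = ∫ ω in (fun ω => (M.history t ω, M.X t ω)) ⁻¹' B ∩ M.potentialOutcome t ⁻¹' C,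
        M.selProb t a ω ∂μ := by
  have hhx : Measurable fun ω => (M.history t ω, M.X t ω) :=
    (hM.measurable_history t).prodMk (hM.measurable_X t)
  have hm : M.histCtx t ≤ mΩ := hhx.comap_le
  have hU : MeasurableSet (M.A t ⁻¹' {a}) := hM.measurable_A t (measurableSet_singleton a)
  have hV : MeasurableSet (M.potentialOutcome t ⁻¹' C) := hM.measurable_potentialOutcome t hC
  set H := (fun ω => (M.history t ω, M.X t ω)) ⁻¹' B with hH
  set V := M.potentialOutcome t ⁻¹' C with hVdef
  have hHm : MeasurableSet[M.histCtx t] H := ⟨B, hB, rfl⟩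
  have hH' : MeasurableSet H := hm _ hHm
  have hp : StronglyMeasurable[M.histCtx t] (M.selProb t a) := by
    refine Measurable.stronglyMeasurable ?_
    exact (M.policy.measurable_prob t a).comp
      (comap_measurable (fun ω => (M.history t ω, M.X t ω)))
  have hindV : Integrable (V.indicator fun _ => (1 : ℝ)) μ := (integrable_const 1).indicator hV
  have hpV : Integrable (M.selProb t a * V.indicator fun _ => (1 : ℝ)) μ := by
    refine hindV.bdd_mul (c := 1) (hM.measurable_selProb t a).aestronglyMeasurable
      (ae_of_all _ fun ω => ?_)
    rw [Real.norm_eq_abs, abs_of_nonneg (M.selProb_nonneg t a ω)]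
    exact M.selProb_le_one t a ω
  calc μ.real (M.A t ⁻¹' {a} ∩ (H ∩ V))
      = ∫ ω in H, (M.A t ⁻¹' {a} ∩ V).indicator (fun _ => (1 : ℝ)) ω ∂μ := by
        rw [integral_indicator (hU.inter hV), setIntegral_const, smul_eq_mul, mul_one,
          measureReal_restrict_apply (hU.inter hV)]
        congr 1
        ext ω
        simp only [Set.mem_inter_iff]
        tauto
    _ = ∫ ω in H, (μ[(M.A t ⁻¹' {a} ∩ V).indicator (fun _ => (1 : ℝ)) | M.histCtx t]) ω ∂μ :=
        (setIntegral_condExp hm ((integrable_const 1).indicator (hU.inter hV)) hHm).symm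
    _ = ∫ ω in H, (μ[M.selProb t a * V.indicator (fun _ => (1 : ℝ)) | M.histCtx t]) ω ∂μ := by
        refine setIntegral_congr_ae hH' ?_
        filter_upwards [hM.unconfounded t {a} C (measurableSet_singleton a) hC,
          hM.action_law t a, condExp_mul_of_stronglyMeasurable_left hp hpV hindV]
          with ω h1 h2 h3 _
        rw [h1, h2, h3]
        rfl
    _ = ∫ ω in H, (M.selProb t a * V.indicator (fun _ => (1 : ℝ))) ω ∂μ :=
        setIntegral_condExp hm hpV hHm
    _ = ∫ ω in H ∩ V, M.selProb t a ω ∂μ := by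
        rw [← setIntegral_indicator hV]
        refine setIntegral_congr_fun hH' fun ω _ => ?_
        by_cases hv : ω ∈ V <;> simp [hv]

/-- On functions of the history, the context and the potential outcomes, restricting to the event
`A_t = a` amounts to weighting with the selection probability. -/
theorem setIntegral_action {E : Type*} [NormedAddCommGroup E] [NormedSpace ℝ E]
    (hM : M.IsNoisyContextBandit μ) (t : ℕ) (a : Fin K)
    {g : ((Fin t → Rec d K) × Vec d) × (Fin K → ℝ) → E} (hg : StronglyMeasurable g) :
    ∫ ω in M.A t ⁻¹' {a}, g ((M.history t ω, M.X t ω), M.potentialOutcome t ω) ∂μ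
      = ∫ ω, M.selProb t a ω • g ((M.history t ω, M.X t ω), M.potentialOutcome t ω) ∂μ := by
  have hhx : Measurable fun ω => (M.history t ω, M.X t ω) :=
    (hM.measurable_history t).prodMk (hM.measurable_X t)
  have hΦ : Measurable fun ω => ((M.history t ω, M.X t ω), M.potentialOutcome t ω) :=
    hhx.prodMk (hM.measurable_potentialOutcome t)
  have hU : MeasurableSet (M.A t ⁻¹' {a}) := hM.measurable_A t (measurableSet_singleton a)
  have hdens : Measurable fun ω => ENNReal.ofReal (M.selProb t a ω) :=
    (hM.measurable_selProb t a).ennreal_ofReal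
  have hpi : Integrable (M.selProb t a) μ := by
    refine Integrable.of_bound (hM.measurable_selProb t a).aestronglyMeasurable 1
      (ae_of_all _ fun ω => ?_)
    rw [Real.norm_eq_abs, abs_of_nonneg (M.selProb_nonneg t a ω)]
    exact M.selProb_le_one t a ω
  -- The restriction to A_t = a and the measure with density π_t have image laws that agree on
  -- rectangles, hence everywhere. The identity for sets thereby extends to all integrands.
  have hlaw : (μ.restrict (M.A t ⁻¹' {a})).map
        (fun ω => ((M.history t ω, M.X t ω), M.potentialOutcome t ω))
      = (μ.withDensity fun ω => ENNReal.ofReal (M.selProb t a ω)).map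
        (fun ω => ((M.history t ω, M.X t ω), M.potentialOutcome t ω)) := by
    refine Measure.ext_prod fun {B C} hB hC => ?_
    have hpre : MeasurableSet ((fun ω => ((M.history t ω, M.X t ω), M.potentialOutcome t ω)) ⁻¹'
        (B ×ˢ C)) := hΦ (hB.prod hC)
    rw [Measure.map_apply hΦ (hB.prod hC), Measure.map_apply hΦ (hB.prod hC),
      withDensity_apply _ hpre, Measure.restrict_apply hpre,
      ← ofReal_integral_eq_lintegral_ofReal hpi.integrableOn
        (ae_of_all _ fun ω => M.selProb_nonneg t a ω), ← ofReal_measureReal]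
    congr 1
    rw [Set.inter_comm]
    exact hM.measureReal_action_inter t a hB hC
  rw [← integral_map_of_stronglyMeasurable hΦ hg, hlaw, integral_map_of_stronglyMeasurable hΦ hg,
    integral_withDensity_eq_integral_toReal_smul hdens (ae_of_all _ fun _ => ENNReal.ofReal_lt_top)]
  simp_rw [ENNReal.toReal_ofReal (M.selProb_nonneg t a _)]

variable {pmin : ℝ}

/-- Restricting to A_t = a amounts to multiplying by π_t, which cancels the weight; the remaining
f(X_t, Y_t(a)) is independent of the history and has the law of round r. Real W serve the law of
large numbers, complex W the central limit theorem. No integrability is needed, as both steps are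
compatible with the value 0 of a divergent Bochner integral. -/
theorem integral_history_mul_weight {𝕜 : Type*} [RCLike 𝕜] (hM : M.IsNoisyContextBandit μ)
    (hp0 : 0 < pmin) (hpm : ∀ t a, ∀ᵐ ω ∂μ, pmin ≤ M.selProb t a ω) (r t : ℕ) (a : Fin K)
    {W : (Fin t → Rec d K) → 𝕜} (hW : Measurable W) {f : Vec d × ℝ → ℝ} (hf : Measurable f) :
    ∫ ω, W (M.history t ω) * ((M.weight a t ω * f (M.obsPair t ω) : ℝ) : 𝕜) ∂μ
      = (∫ ω, W (M.history t ω) ∂μ) * ((∫ ω, f (M.armPair a r ω) ∂μ : ℝ) : 𝕜) := by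
  let g : ((Fin t → Rec d K) × Vec d) × (Fin K → ℝ) → 𝕜 := fun q =>
    W q.1.1 * ((1 / M.policy.prob t q.1.1 q.1.2 a * f (q.1.2, q.2 a) : ℝ) : 𝕜)
  have hg : Measurable g := by
    have h1 : Measurable fun q : ((Fin t → Rec d K) × Vec d) × (Fin K → ℝ) =>
        M.policy.prob t q.1.1 q.1.2 a := (M.policy.measurable_prob t a).comp measurable_fst
    have h2 : Measurable fun q : ((Fin t → Rec d K) × Vec d) × (Fin K → ℝ) =>
        f (q.1.2, q.2 a) := hf.comp (by fun_prop)
    refine (hW.comp (measurable_fst.comp measurable_fst)).mul ?_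
    exact RCLike.measurable_ofReal.comp ((h1.const_div 1).mul h2)
  have hU : MeasurableSet (M.A t ⁻¹' {a}) := hM.measurable_A t (measurableSet_singleton a)
  calc ∫ ω, W (M.history t ω) * ((M.weight a t ω * f (M.obsPair t ω) : ℝ) : 𝕜) ∂μ
      = ∫ ω, (M.A t ⁻¹' {a}).indicator
          (fun ω => g ((M.history t ω, M.X t ω), M.potentialOutcome t ω)) ω ∂μ := by
        congr 1
        ext ω
        have := M.weight_mul_obsPair a t ω f
        simp only [smul_eq_mul] at this
        rw [this, weight_eq]
        by_cases hA : M.A t ω = a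
        · rw [Set.indicator_of_mem (by exact hA), if_pos hA]
          rfl
        · rw [Set.indicator_of_notMem (by exact hA), if_neg hA]
          simp
    _ = ∫ ω, M.selProb t a ω • g ((M.history t ω, M.X t ω), M.potentialOutcome t ω) ∂μ := by
        rw [integral_indicator hU, hM.setIntegral_action t a hg.stronglyMeasurable]
    _ = ∫ ω, W (M.history t ω) * ((f (M.armPair a t ω) : ℝ) : 𝕜) ∂μ := by
        refine integral_congr_ae ?_
        filter_upwards [hpm t a] with ω hω
        have hne : M.selProb t a ω ≠ 0 := (hp0.trans_le hω).ne'
        have hne' : ((M.selProb t a ω : ℝ) : 𝕜) ≠ 0 := by exact_mod_cast hne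
        change M.selProb t a ω • (W (M.history t ω)
          * ((1 / M.selProb t a ω * f (M.armPair a t ω) : ℝ) : 𝕜)) = _
        rw [RCLike.real_smul_eq_coe_mul]
        push_cast
        field_simp
    _ = _ := by
        have hind : IndepFun (fun ω => W (M.history t ω))
            (fun ω => ((f (M.armPair a t ω) : ℝ) : 𝕜)) μ :=
          ((hM.indep_history t).comp
            (φ := fun q : Vec d × (Fin K → ℝ) => ((f (q.1, q.2 a) : ℝ) : 𝕜)) (ψ := W)
            (RCLike.measurable_ofReal.comp (hf.comp (by fun_prop))) hW).symm
        have hWm : AEStronglyMeasurable (fun ω => W (M.history t ω)) μ :=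
          (hW.comp (hM.measurable_history t)).aestronglyMeasurable
        have hfm : AEStronglyMeasurable (fun ω => ((f (M.armPair a t ω) : ℝ) : 𝕜)) μ :=
          (RCLike.measurable_ofReal.comp
            (hf.comp (hM.measurable_armPair a t))).aestronglyMeasurable
        have := hind.integral_mul_eq_mul_integral hWm hfm
        simp only [Pi.mul_apply] at this
        rw [this, integral_ofReal, hM.integral_armPair a t r hf]

/-- Law of large numbers for inverse probability weighted averages. -/
theorem tendstoInMeasure_average_weight (hM : M.IsNoisyContextBandit μ) (hp0 : 0 < pmin)
    (hpm : ∀ t a, ∀ᵐ ω ∂μ, pmin ≤ M.selProb t a ω) (r : ℕ) (a : Fin K)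
    {f : Vec d × ℝ → ℝ} (hf : Measurable f) (h : MemLp (fun ω => f (M.armPair a r ω)) 2 μ) :
    TendstoInMeasure μ (fun (T : ℕ) ω =>
        (1 / (T : ℝ)) * ∑ t ∈ Finset.range T, M.weight a t ω * f (M.obsPair t ω)) atTop
      (fun _ => ∫ ω, f (M.armPair a r ω) ∂μ) := by
  set c := ∫ ω, f (M.armPair a r ω) ∂μ with hc
  have hwf : ∀ t, MemLp (fun ω => M.weight a t ω * f (M.obsPair t ω)) 2 μ :=
    fun t => hM.memLp_weight_mul hp0 hpm t a hf h
  have hD : ∀ t, MemLp (fun ω => M.weight a t ω * f (M.obsPair t ω) - c) 2 μ :=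
    fun t => (hwf t).sub (memLp_const c)
  -- Uses (wf − c)² ≤ 2w²f² + 2c² and w ≤ 1/pmin, and expresses the bound at the fixed round r so
  -- that it does not depend on t.
  have hbound : ∀ t, ∫ ω, (M.weight a t ω * f (M.obsPair t ω) - c) ^ 2 ∂μ
      ≤ ∫ ω, 2 * (1 / pmin) ^ 2 * f (M.armPair a r ω) ^ 2 + 2 * c ^ 2 ∂μ := by
    intro t
    have hf2 : Measurable fun q => 2 * (1 / pmin) ^ 2 * f q ^ 2 + 2 * c ^ 2 := by fun_prop
    rw [hM.integral_armPair a r t hf2]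
    refine integral_mono_ae (hD t).integrable_sq
      (((hM.memLp_armPair a t hf h).integrable_sq.const_mul _).add (integrable_const _)) ?_
    filter_upwards [weight_le hp0 hpm a t] with ω hω
    have := M.weight_mul_obsPair a t ω f
    simp only [smul_eq_mul] at this
    rw [this]
    have h1 : M.weight a t ω ^ 2 ≤ (1 / pmin) ^ 2 := by
      gcongr
      exact M.weight_nonneg a t ω
    have h2 := mul_le_mul_of_nonneg_right h1 (sq_nonneg (f (M.armPair a t ω)))
    nlinarith [sq_nonneg (M.weight a t ω * f (M.armPair a t ω) + c)]
  have horth : ∀ s t, s < t → ∫ ω, (M.weight a s ω * f (M.obsPair s ω) - c)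
      * (M.weight a t ω * f (M.obsPair t ω) - c) ∂μ = 0 := by
    intro s t hst
    -- The centred term of round s, as a function of the history before t. Then E[W · w_t f] = c
    -- E[W] = E[W · c], which is the orthogonality.
    let W : (Fin t → Rec d K) → ℝ := fun q =>
      (if (q ⟨s, hst⟩).2.2.1 = a then 1 else 0) / (q ⟨s, hst⟩).2.1
        * f ((q ⟨s, hst⟩).1, (q ⟨s, hst⟩).2.2.2) - c
    have hWm : Measurable W := by
      have h1 : Measurable fun q : Fin t → Rec d K =>
          if (q ⟨s, hst⟩).2.2.1 = a then (1 : ℝ) else 0 :=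
        Measurable.ite ((show Measurable fun q : Fin t → Rec d K => (q ⟨s, hst⟩).2.2.1 by
          fun_prop) (measurableSet_singleton a)) measurable_const measurable_const
      have h2 : Measurable fun q : Fin t → Rec d K =>
          f ((q ⟨s, hst⟩).1, (q ⟨s, hst⟩).2.2.2) := hf.comp (by fun_prop)
      exact ((h1.div (by fun_prop)).mul h2).sub_const c
    have hWs : ∀ ω, W (M.history t ω) = M.weight a s ω * f (M.obsPair s ω) - c := by
      intro ω
      simp only [W, history_apply]
      rfl
    have hmain := hM.integral_history_mul_weight (𝕜 := ℝ) hp0 hpm r t a hWm hf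
    simp only [hWs, RCLike.ofReal_real_eq_id, id_eq] at hmain
    have hprod : Integrable (fun ω => (M.weight a s ω * f (M.obsPair s ω) - c)
        * (M.weight a t ω * f (M.obsPair t ω))) μ := (hD s).integrable_mul (hwf t)
    have hlin : Integrable (fun ω => (M.weight a s ω * f (M.obsPair s ω) - c) * c) μ :=
      ((hD s).integrable (by norm_num)).mul_const c
    simp_rw [mul_sub (M.weight a s _ * f (M.obsPair s _) - c)]
    rw [integral_sub hprod hlin, hmain, integral_mul_const, ← hc, sub_self]
  have hlim := tendstoInMeasure_average_of_orthogonal hD hbound horth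
  have hadd := TendstoInMeasure.comp_continuousAt hlim (g := fun x => x + c)
    (by fun_prop : Continuous fun x : ℝ => x + c).continuousAt
  simp only [zero_add] at hadd
  refine hadd.congr' ?_ EventuallyEq.rfl
  -- At T = 0 the average is 0 while the recentred expression equals c.
  filter_upwards [eventually_gt_atTop 0] with T hT
  refine ae_of_all _ fun ω => ?_
  have hT' : (T : ℝ) ≠ 0 := by exact_mod_cast hT.ne'
  simp only [Finset.sum_sub_distrib, Finset.sum_const, Finset.card_range, nsmul_eq_mul]
  field_simp
  ring

end InverseProbabilityWeighting

end IsNoisyContextBandit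

end Model

theorem memLp_two_mul_of_memLp_four {Ω : Type*} {mΩ : MeasurableSpace Ω} {μ : Measure Ω}
    {f g : Ω → ℝ} (hf : MemLp f 4 μ) (hg : MemLp g 4 μ) : MemLp (fun ω => f ω * g ω) 2 μ := by
  have : ENNReal.HolderTriple 4 4 2 := ⟨by
    rw [← ENNReal.toReal_eq_toReal_iff' (by simp) (by simp),
      ENNReal.toReal_add (by simp) (by simp)]
    simp only [ENNReal.toReal_inv, ENNReal.toReal_ofNat]
    norm_num⟩
  exact hg.mul hf

/-! ### Replacing the behavior policy by its limit; weighted central limit theorem -/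

namespace Model

variable {d K : ℕ} {Ω : Type*} {mΩ : MeasurableSpace Ω} {μ : Measure Ω} {M : Model d K Ω}

namespace IsNoisyContextBandit

variable {pmin : ℝ} {pibar : StationaryPolicy d K}

/-- The limit policy inherits the minimum sampling probability. -/
theorem le_pibar (hM : M.IsNoisyContextBandit μ)
    (hpm : ∀ t a, ∀ᵐ ω ∂μ, pmin ≤ M.selProb t a ω) (hconv : M.PolicyConverges μ pibar)
    (t : ℕ) (a : Fin K) : ∀ᵐ ω ∂μ, pmin ≤ pibar.prob (M.X t ω) a := by
  -- The probability is the same in every round s since X_s has the law of X_t. In round s the event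
  -- forces π_s − pibar ≥ ε, whose probability tends to 0; a constant sequence bounded by a null
  -- sequence is zero.
  have hzero : ∀ ε > 0, μ {ω | pibar.prob (M.X t ω) a ≤ pmin - ε} = 0 := by
    intro ε hε
    have hset : MeasurableSet {x : Vec d | pibar.prob x a ≤ pmin - ε} :=
      measurableSet_le (pibar.measurable_prob a) measurable_const
    have hlim := (tendstoInMeasure_iff_norm.1 (hconv a)) ε hε
    refine le_antisymm (ge_of_tendsto' hlim fun s => ?_) zero_le
    calc μ {ω | pibar.prob (M.X t ω) a ≤ pmin - ε}
        = μ {ω | pibar.prob (M.X s ω) a ≤ pmin - ε} :=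
          (hM.identDistrib_X t s).measure_mem_eq hset
      _ ≤ _ := by
          refine measure_mono_ae ?_
          filter_upwards [hpm s a] with ω h1 h2
          have h2' : pibar.prob (M.X s ω) a ≤ pmin - ε := h2
          change ε ≤ ‖M.selProb s a ω - pibar.prob (M.X s ω) a - 0‖
          rw [sub_zero]
          exact le_trans (by linarith) (le_abs_self _)
  have hall : ∀ᵐ ω ∂μ, ∀ n : ℕ, ¬ pibar.prob (M.X t ω) a ≤ pmin - 1 / ((n : ℝ) + 1) := by
    rw [ae_all_iff]
    intro n
    rw [ae_iff]
    simpa using hzero (1 / ((n : ℝ) + 1)) (by positivity)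
  filter_upwards [hall] with ω hω
  by_contra hlt
  obtain ⟨n, hn⟩ := exists_nat_one_div_lt (sub_pos.2 (not_le.1 hlt))
  exact hω n (by linarith)

theorem measurable_pibar (hM : M.IsNoisyContextBandit μ) (t : ℕ) (a : Fin K) :
    Measurable fun ω => pibar.prob (M.X t ω) a :=
  (pibar.measurable_prob a).comp (hM.measurable_X t)

theorem abs_inv_sub_inv_le (hM : M.IsNoisyContextBandit μ) (hp0 : 0 < pmin)
    (hpm : ∀ t a, ∀ᵐ ω ∂μ, pmin ≤ M.selProb t a ω) (hconv : M.PolicyConverges μ pibar)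
    (t : ℕ) (a : Fin K) :
    ∀ᵐ ω ∂μ, |1 / M.selProb t a ω - 1 / pibar.prob (M.X t ω) a| ≤ 2 / pmin := by
  filter_upwards [hpm t a, hM.le_pibar hpm hconv t a] with ω h1 h2
  have h3 := one_div_le_one_div_of_le hp0 h1
  have h4 := one_div_le_one_div_of_le hp0 h2
  have h5 : 0 < 1 / M.selProb t a ω := one_div_pos.2 (hp0.trans_le h1)
  have h6 : 0 < 1 / pibar.prob (M.X t ω) a := one_div_pos.2 (hp0.trans_le h2)
  have h7 : 2 / pmin = 1 / pmin + 1 / pmin := by ring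
  rw [abs_le, h7]
  constructor <;> linarith

theorem memLp_div_pibar (hM : M.IsNoisyContextBandit μ) (hp0 : 0 < pmin)
    (hpm : ∀ t a, ∀ᵐ ω ∂μ, pmin ≤ M.selProb t a ω) (hconv : M.PolicyConverges μ pibar)
    (t : ℕ) (a : Fin K) {f : Vec d × ℝ → ℝ} (hf : Measurable f) {p : ENNReal}
    (h : MemLp (fun ω => f (M.armPair a t ω)) p μ) :
    MemLp (fun ω => 1 / pibar.prob (M.X t ω) a * f (M.armPair a t ω)) p μ := by
  refine h.of_le_mul (c := 1 / pmin)
    (((hM.measurable_pibar t a).const_div 1).mul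
      (hf.comp (hM.measurable_armPair a t))).aestronglyMeasurable ?_
  filter_upwards [hM.le_pibar hpm hconv t a] with ω hω
  rw [norm_mul]
  have h0 : 0 ≤ 1 / pibar.prob (M.X t ω) a := one_div_nonneg.2 (pibar.prob_nonneg _ _)
  rw [Real.norm_of_nonneg h0]
  gcongr

theorem measurable_div_pibar (pibar : StationaryPolicy d K) (a : Fin K) {f : Vec d × ℝ → ℝ}
    (hf : Measurable f) : Measurable fun q : Vec d × ℝ => 1 / pibar.prob q.1 a * f q :=
  (((pibar.measurable_prob a).comp measurable_fst).const_div 1).mul hf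

/-- In 1_{A_t = a}/π_t² one factor stays as the weight and the other is exchanged for 1/pibar. This
bounds the exchange error by an integral free of the action. -/
theorem integral_abs_weight_mul_le (hM : M.IsNoisyContextBandit μ) (hp0 : 0 < pmin)
    (hpm : ∀ t a, ∀ᵐ ω ∂μ, pmin ≤ M.selProb t a ω) (hconv : M.PolicyConverges μ pibar)
    (r t : ℕ) (a : Fin K) {f : Vec d × ℝ → ℝ} (hf : Measurable f)
    (h : MemLp (fun ω => f (M.armPair a r ω)) 1 μ) :
    Integrable (fun ω => M.weight a t ω * (1 / M.selProb t a ω - 1 / pibar.prob (M.X t ω) a)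
      * f (M.obsPair t ω)) μ ∧
    ∫ ω, |M.weight a t ω * (1 / M.selProb t a ω - 1 / pibar.prob (M.X t ω) a)
      * f (M.obsPair t ω)| ∂μ
      ≤ 1 / pmin * ∫ ω, |1 / M.selProb t a ω - 1 / pibar.prob (M.X t ω) a|
        * |f (M.armPair a t ω)| ∂μ := by
  have hΔm : Measurable fun ω => 1 / M.selProb t a ω - 1 / pibar.prob (M.X t ω) a :=
    ((hM.measurable_selProb t a).const_div 1).sub ((hM.measurable_pibar t a).const_div 1)
  have hi : Integrable (fun ω => |1 / M.selProb t a ω - 1 / pibar.prob (M.X t ω) a|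
      * |f (M.armPair a t ω)|) μ := by
    refine (memLp_one_iff_integrable.1 (hM.memLp_armPair a t hf h)).abs.bdd_mul
      (c := 2 / pmin) hΔm.abs.aestronglyMeasurable ?_
    filter_upwards [hM.abs_inv_sub_inv_le hp0 hpm hconv t a] with ω hω
    simpa using hω
  have hle : ∀ᵐ ω ∂μ, |M.weight a t ω * (1 / M.selProb t a ω - 1 / pibar.prob (M.X t ω) a)
      * f (M.obsPair t ω)| ≤ 1 / pmin * (|1 / M.selProb t a ω - 1 / pibar.prob (M.X t ω) a|
        * |f (M.armPair a t ω)|) := by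
    filter_upwards [weight_le hp0 hpm a t] with ω hω
    have := M.weight_mul_obsPair a t ω f
    simp only [smul_eq_mul] at this
    rw [mul_right_comm, this, abs_mul, abs_mul, abs_of_nonneg (M.weight_nonneg a t ω),
      mul_assoc, mul_comm |f _|]
    gcongr
  have hint : Integrable (fun ω => M.weight a t ω
      * (1 / M.selProb t a ω - 1 / pibar.prob (M.X t ω) a) * f (M.obsPair t ω)) μ :=
    (hi.const_mul (1 / pmin)).mono' (((hM.measurable_weight a t).mul hΔm).mul
      (hf.comp (hM.measurable_obsPair t))).aestronglyMeasurable hle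
  refine ⟨hint, ?_⟩
  rw [← integral_const_mul]
  exact integral_mono_ae hint.abs (hi.const_mul _) hle

variable [IsProbabilityMeasure μ]

theorem tendsto_integral_abs_inv_sub_inv (hM : M.IsNoisyContextBandit μ) (hp0 : 0 < pmin)
    (hpm : ∀ t a, ∀ᵐ ω ∂μ, pmin ≤ M.selProb t a ω) (hconv : M.PolicyConverges μ pibar)
    (a : Fin K) :
    Tendsto (fun t => ∫ ω, |1 / M.selProb t a ω - 1 / pibar.prob (M.X t ω) a| ∂μ) atTop
      (𝓝 0) := by
  refine tendsto_integral_abs_of_tendstoInMeasure (C := 2 / pmin)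
    (fun t => (((hM.measurable_selProb t a).const_div 1).sub
      ((hM.measurable_pibar t a).const_div 1)).aemeasurable)
    (fun t => hM.abs_inv_sub_inv_le hp0 hpm hconv t a) ?_
  rw [tendstoInMeasure_iff_norm]
  intro ε hε
  -- Since |1/π − 1/pibar| = |π − pibar|/(π pibar) with both factors at least pmin, a difference of
  -- at least ε forces |π − pibar| ≥ ε pmin².
  have hlim := (tendstoInMeasure_iff_norm.1 (hconv a)) (ε * pmin ^ 2) (by positivity)
  refine tendsto_of_tendsto_of_tendsto_of_le_of_le tendsto_const_nhds hlim
    (fun _ => zero_le) fun t => measure_mono_ae ?_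
  filter_upwards [hpm t a, hM.le_pibar hpm hconv t a] with ω h1 h2 h3
  have h1' := hp0.trans_le h1
  have h2' := hp0.trans_le h2
  replace h3 : ε ≤ ‖1 / M.selProb t a ω - 1 / pibar.prob (M.X t ω) a - 0‖ := h3
  change ε * pmin ^ 2 ≤ ‖M.selProb t a ω - pibar.prob (M.X t ω) a - 0‖
  rw [sub_zero, Real.norm_eq_abs] at h3 ⊢
  rw [div_sub_div _ _ h1'.ne' h2'.ne', one_mul, mul_one, abs_div, abs_sub_comm,
    abs_of_pos (mul_pos h1' h2'), le_div_iff₀ (mul_pos h1' h2')] at h3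
  refine le_trans ?_ h3
  rw [sq]
  gcongr

/-- The error made by replacing `π_t` with its limit vanishes in mean. -/
theorem tendsto_integral_abs_inv_sub_inv_mul (hM : M.IsNoisyContextBandit μ) (hp0 : 0 < pmin)
    (hpm : ∀ t a, ∀ᵐ ω ∂μ, pmin ≤ M.selProb t a ω) (hconv : M.PolicyConverges μ pibar)
    (r : ℕ) (a : Fin K) {f : Vec d × ℝ → ℝ} (hf : Measurable f)
    (h : MemLp (fun ω => f (M.armPair a r ω)) 2 μ) :
    Tendsto (fun t => ∫ ω, |1 / M.selProb t a ω - 1 / pibar.prob (M.X t ω) a|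
      * |f (M.armPair a t ω)| ∂μ) atTop (𝓝 0) := by
  set F := ∫ ω, f (M.armPair a r ω) ^ 2 ∂μ with hF
  have hF0 : 0 ≤ F := integral_nonneg fun _ => sq_nonneg _
  have hft := fun t => hM.memLp_armPair a t hf h
  have hFt : ∀ t, ∫ ω, f (M.armPair a t ω) ^ 2 ∂μ = F := fun t =>
    hM.integral_armPair a t r (hf.pow_const 2)
  have hΔm : ∀ t, Measurable fun ω => |1 / M.selProb t a ω - 1 / pibar.prob (M.X t ω) a| :=
    fun t => (((hM.measurable_selProb t a).const_div 1).sub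
      ((hM.measurable_pibar t a).const_div 1)).abs
  have hΔi : ∀ t, Integrable
      (fun ω => |1 / M.selProb t a ω - 1 / pibar.prob (M.X t ω) a|) μ := fun t =>
    Integrable.of_bound (hΔm t).aestronglyMeasurable (2 / pmin) (by
      filter_upwards [hM.abs_inv_sub_inv_le hp0 hpm hconv t a] with ω hω
      simpa using hω)
  -- Young's inequality xy ≤ x²/(2ε) + εy²/2, followed by x² ≤ (2/pmin) x, reduces the claim to
  -- convergence of the mean of x.
  have key : ∀ ε > 0, ∀ t, ∫ ω, |1 / M.selProb t a ω - 1 / pibar.prob (M.X t ω) a|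
      * |f (M.armPair a t ω)| ∂μ
      ≤ (1 / (pmin * ε)) * ∫ ω, |1 / M.selProb t a ω - 1 / pibar.prob (M.X t ω) a| ∂μ
        + ε / 2 * F := by
    intro ε hε t
    have hle : ∀ᵐ ω ∂μ, |1 / M.selProb t a ω - 1 / pibar.prob (M.X t ω) a|
        * |f (M.armPair a t ω)| ≤ (1 / (pmin * ε)) *
          |1 / M.selProb t a ω - 1 / pibar.prob (M.X t ω) a| + ε / 2 * f (M.armPair a t ω) ^ 2 := by
      filter_upwards [hM.abs_inv_sub_inv_le hp0 hpm hconv t a] with ω hω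
      set x := |1 / M.selProb t a ω - 1 / pibar.prob (M.X t ω) a|
      have hx : 0 ≤ x := abs_nonneg _
      rw [← sq_abs (f (M.armPair a t ω))]
      set y := |f (M.armPair a t ω)|
      have h1 : x * y ≤ x ^ 2 / (2 * ε) + ε / 2 * y ^ 2 := by
        have : x ^ 2 / (2 * ε) + ε / 2 * y ^ 2 - x * y = (x - ε * y) ^ 2 / (2 * ε) := by
          field_simp
          ring
        have h0 : 0 ≤ (x - ε * y) ^ 2 / (2 * ε) := by positivity
        linarith
      have h2 : x ^ 2 / (2 * ε) ≤ 1 / (pmin * ε) * x := by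
        calc x ^ 2 / (2 * ε) = x * x / (2 * ε) := by ring
          _ ≤ (2 / pmin) * x / (2 * ε) := by gcongr
          _ = 1 / (pmin * ε) * x := by field_simp
      linarith
    have hi2 : Integrable (fun ω => ε / 2 * f (M.armPair a t ω) ^ 2) μ :=
      (hft t).integrable_sq.const_mul _
    calc _ ≤ ∫ ω, ((1 / (pmin * ε)) * |1 / M.selProb t a ω - 1 / pibar.prob (M.X t ω) a|
          + ε / 2 * f (M.armPair a t ω) ^ 2) ∂μ :=
          integral_mono_of_nonneg (ae_of_all _ fun ω => by positivity)
            (((hΔi t).const_mul _).add hi2) hle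
      _ = _ := by
          rw [integral_add ((hΔi t).const_mul _) hi2, integral_const_mul, integral_const_mul,
            hFt]
  rw [Metric.tendsto_nhds]
  intro ε hε
  -- Dividing by F + 1 makes the second term smaller than ε even when F = 0.
  have hε' : 0 < ε / (F + 1) := by positivity
  have hlim := ((hM.tendsto_integral_abs_inv_sub_inv hp0 hpm hconv a).const_mul
    (1 / (pmin * (ε / (F + 1))))).add_const (ε / (F + 1) / 2 * F)
  rw [mul_zero, zero_add] at hlim
  have hlt : ε / (F + 1) / 2 * F < ε := by
    rw [div_div, div_mul_eq_mul_div, div_lt_iff₀ (by positivity)]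
    nlinarith
  filter_upwards [hlim.eventually_lt_const hlt] with t ht
  rw [Real.dist_eq, sub_zero, abs_of_nonneg (integral_nonneg fun _ => by positivity)]
  exact (key _ hε' t).trans_lt ht

/-- Law of large numbers for averages weighted by `1_{A_t = a} / π_t(a)²`. -/
theorem tendstoInMeasure_average_weight_div (hM : M.IsNoisyContextBandit μ) (hp0 : 0 < pmin)
    (hpm : ∀ t a, ∀ᵐ ω ∂μ, pmin ≤ M.selProb t a ω) (hconv : M.PolicyConverges μ pibar)
    (r : ℕ) (a : Fin K) {f : Vec d × ℝ → ℝ} (hf : Measurable f)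
    (h : MemLp (fun ω => f (M.armPair a r ω)) 2 μ) :
    TendstoInMeasure μ (fun (T : ℕ) ω => (1 / (T : ℝ)) * ∑ t ∈ Finset.range T,
        (if M.A t ω = a then 1 else 0) / M.selProb t (M.A t ω) ω ^ 2 * f (M.obsPair t ω)) atTop
      (fun _ => ∫ ω, 1 / pibar.prob (M.X r ω) a * f (M.armPair a r ω) ∂μ) := by
  have h1 := hM.tendstoInMeasure_average_weight hp0 hpm r a (measurable_div_pibar pibar a hf)
    (hM.memLp_div_pibar hp0 hpm hconv r a hf h)
  -- The exchange error of round t: w/π_t = w/pibar + w(1/π_t − 1/pibar). The first part obeys the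
  -- law of large numbers above, and averages of the second vanish in L¹ by Cesàro.
  set E : ℕ → Ω → ℝ := fun t ω => M.weight a t ω
    * (1 / M.selProb t a ω - 1 / pibar.prob (M.X t ω) a) * f (M.obsPair t ω) with hE
  have hEi := fun t => (hM.integral_abs_weight_mul_le hp0 hpm hconv r t a hf
    (h.mono_exponent one_le_two))
  have hEi1 : ∀ t, Integrable (E t) μ := fun t => (hEi t).1
  have h2 : TendstoInMeasure μ
      (fun (T : ℕ) ω => (1 / (T : ℝ)) * ∑ t ∈ Finset.range T, E t ω) atTop (fun _ => 0) := by
    refine tendstoInMeasure_of_integral_abs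
      (fun T => (integrable_finsetSum _ fun t _ => hEi1 t).const_mul _) ?_
    have hces := (((hM.tendsto_integral_abs_inv_sub_inv_mul hp0 hpm hconv r a hf h).const_mul
      (1 / pmin)).cesaro)
    rw [mul_zero] at hces
    refine tendsto_of_tendsto_of_tendsto_of_le_of_le tendsto_const_nhds hces
      (fun T => integral_nonneg fun _ => abs_nonneg _) fun T => ?_
    calc ∫ ω, |(1 / (T : ℝ)) * ∑ t ∈ Finset.range T, E t ω| ∂μ
        ≤ ∫ ω, (T : ℝ)⁻¹ * ∑ t ∈ Finset.range T, |E t ω| ∂μ := by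
          refine integral_mono_of_nonneg (ae_of_all _ fun _ => abs_nonneg _)
            ((integrable_finsetSum _ fun t _ => (hEi1 t).abs).const_mul _)
            (ae_of_all _ fun ω => ?_)
          simp only [abs_mul, one_div, abs_inv, Nat.abs_cast]
          gcongr
          exact Finset.abs_sum_le_sum_abs _ _
      _ = (T : ℝ)⁻¹ * ∑ t ∈ Finset.range T, ∫ ω, |E t ω| ∂μ := by
          rw [integral_const_mul, integral_finsetSum _ fun t _ => (hEi1 t).abs]
      _ ≤ _ := by
          gcongr with t _
          exact (hEi t).2
  have h3 := TendstoInMeasure.comp_continuousAt (TendstoInMeasure.prodMk_const h1 h2)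
    (g := fun q : ℝ × ℝ => q.1 + q.2) (by fun_prop : Continuous fun q : ℝ × ℝ => _).continuousAt
  simp only [add_zero] at h3
  refine h3.congr_left fun T => ae_of_all _ fun ω => ?_
  beta_reduce
  rw [← mul_add, ← Finset.sum_add_distrib]
  congr 1
  refine Finset.sum_congr rfl fun t _ => ?_
  simp only [hE, weight_eq, obsPair]
  split_ifs with hA
  · rw [hA]
    ring
  · ring

/-- Central limit theorem for inverse probability weighted sums, in terms of characteristic
functions. -/
theorem tendsto_integral_exp_weighted (hM : M.IsNoisyContextBandit μ) (hp0 : 0 < pmin)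
    (hpm : ∀ t a, ∀ᵐ ω ∂μ, pmin ≤ M.selProb t a ω) (hconv : M.PolicyConverges μ pibar)
    (r : ℕ) {f : Fin K → Vec d × ℝ → ℝ} (hf : ∀ a, Measurable (f a))
    (h : ∀ a, MemLp (fun ω => f a (M.armPair a r ω)) 4 μ)
    (hmean : ∀ a, ∫ ω, f a (M.armPair a r ω) ∂μ = 0) :
    Tendsto (fun T : ℕ => ∫ ω, Complex.exp (((1 / √(T : ℝ)) * ∑ t ∈ Finset.range T,
        ∑ a, M.weight a t ω * f a (M.obsPair t ω) : ℝ) * Complex.I) ∂μ) atTop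
      (𝓝 (Complex.exp (-((∑ a, ∫ ω, 1 / pibar.prob (M.X r ω) a * f a (M.armPair a r ω) ^ 2 ∂μ
        : ℝ) : ℂ) / 2))) := by
  have hsq : ∀ a, MemLp (fun ω => f a (M.armPair a r ω) ^ 2) 2 μ := by
    intro a
    simp_rw [sq]
    exact memLp_two_mul_of_memLp_four (h a) (h a)
  have hw3 : ∀ t a, MemLp (fun ω => M.weight a t ω * f a (M.obsPair t ω)) 3 μ := fun t a =>
    hM.memLp_weight_mul hp0 hpm t a (hf a) ((h a).mono_exponent (by norm_num))
  have hξm : ∀ t, Measurable fun ω => ∑ a, M.weight a t ω * f a (M.obsPair t ω) := fun t =>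
    Finset.measurable_fun_sum _ fun a _ =>
      (hM.measurable_weight a t).mul ((hf a).comp (hM.measurable_obsPair t))
  have hξ3 : ∀ t, MemLp (fun ω => ∑ a, M.weight a t ω * f a (M.obsPair t ω)) 3 μ := fun t =>
    memLp_finsetSum _ fun a _ => hw3 t a
  -- The exponential of the past weighted sum, as a function of the history.
  let W : ℝ → (t : ℕ) → (Fin t → Rec d K) → ℂ := fun v t q =>
    Complex.exp ((v * ∑ s : Fin t, ∑ a, (if (q s).2.2.1 = a then 1 else 0) / (q s).2.1
      * f a ((q s).1, (q s).2.2.2) : ℝ) * Complex.I)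
  have hWm : ∀ v t, Measurable (W v t) := by
    intro v t
    have : Measurable fun q : Fin t → Rec d K =>
        ∑ s : Fin t, ∑ a, (if (q s).2.2.1 = a then (1 : ℝ) else 0) / (q s).2.1
          * f a ((q s).1, (q s).2.2.2) := by
      refine Finset.measurable_fun_sum _ fun s _ => Finset.measurable_fun_sum _ fun a _ => ?_
      have h1 : Measurable fun q : Fin t → Rec d K => if (q s).2.2.1 = a then (1 : ℝ) else 0 :=
        Measurable.ite ((show Measurable fun q : Fin t → Rec d K => (q s).2.2.1 by
          fun_prop) (measurableSet_singleton a)) measurable_const measurable_const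
      have h2 : Measurable fun q : Fin t → Rec d K => f a ((q s).1, (q s).2.2.2) :=
        (hf a).comp (by fun_prop)
      exact (h1.div (by fun_prop)).mul h2
    simp only [W]
    fun_prop
  have hWh : ∀ v t ω, W v t (M.history t ω) = Complex.exp ((v * ∑ s ∈ Finset.range t,
      ∑ a, M.weight a s ω * f a (M.obsPair s ω) : ℝ) * Complex.I) := by
    intro v t ω
    simp only [W, history_apply]
    rw [← Fin.sum_univ_eq_sum_range fun s => ∑ a, M.weight a s ω * f a (M.obsPair s ω)]
    rfl
  have hWn : ∀ v t ω, ‖W v t (M.history t ω)‖ ≤ 1 := fun v t ω =>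
    (Complex.norm_exp_ofReal_mul_I _).le
  have hWhm : ∀ v t, AEStronglyMeasurable (fun ω => W v t (M.history t ω)) μ := fun v t =>
    ((hWm v t).comp (hM.measurable_history t)).aestronglyMeasurable
  let g : Fin K → Vec d × ℝ → ℝ := fun a q => 1 / pibar.prob q.1 a * f a q ^ 2
  have hgm : ∀ a, Measurable (g a) := fun a => measurable_div_pibar pibar a ((hf a).pow_const 2)
  have hg2 : ∀ a, MemLp (fun ω => g a (M.armPair a r ω)) 2 μ := fun a =>
    hM.memLp_div_pibar hp0 hpm hconv r a ((hf a).pow_const 2) (hsq a)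
  have hg1 : ∀ t a, Integrable (fun ω => M.weight a t ω * g a (M.obsPair t ω)) μ := fun t a =>
    (hM.memLp_weight_mul hp0 hpm t a (hgm a) (hg2 a)).integrable (by norm_num)
  let E : Fin K → ℕ → Ω → ℝ := fun a t ω => M.weight a t ω
    * (1 / M.selProb t a ω - 1 / pibar.prob (M.X t ω) a) * f a (M.obsPair t ω) ^ 2
  have hE := fun a t => hM.integral_abs_weight_mul_le hp0 hpm hconv r t a ((hf a).pow_const 2)
    ((hsq a).mono_exponent one_le_two)
  have hEi : ∀ a t, Integrable (E a t) μ := fun a t => (hE a t).1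
  -- Products for distinct arms vanish and w² = w/π_t, so the squared increment is a weighted term,
  -- with mean independent of the past, plus exchange errors.
  have hdec : ∀ t ω, (∑ a, M.weight a t ω * f a (M.obsPair t ω)) ^ 2
      = ∑ a, (M.weight a t ω * g a (M.obsPair t ω) + E a t ω) := by
    intro t ω
    rw [sq, Finset.sum_mul_sum]
    refine Finset.sum_congr rfl fun a _ => ?_
    rw [Finset.sum_eq_single a]
    · simp only [g, E, weight_eq, obsPair]
      split_ifs <;> ring
    · intro b _ hb
      have := M.weight_mul_weight_of_ne hb.symm t ω
      linear_combination (f a (M.obsPair t ω) * f b (M.obsPair t ω)) * this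
    · simp
  refine tendsto_integral_exp_of_martingale_difference (μ := μ)
    (ξ := fun t ω => ∑ a, M.weight a t ω * f a (M.obsPair t ω))
    (C := ∫ ω, (∑ a, 1 / pmin * |f a (M.armPair a r ω)|) ^ 3 ∂μ)
    (δ := fun t => ∑ a, 1 / pmin * ∫ ω, |1 / M.selProb t a ω - 1 / pibar.prob (M.X t ω) a|
      * |f a (M.armPair a t ω) ^ 2| ∂μ) hξm hξ3 ?_ ?_ ?_ ?_ ?_
  · refine Finset.sum_nonneg fun a _ => integral_nonneg fun ω => ?_
    exact mul_nonneg (one_div_nonneg.2 (pibar.prob_nonneg _ _)) (sq_nonneg _)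
  · intro t
    -- The third moment bound mixes all arms, so equality of the joint laws of the potential
    -- outcomes is used here.
    have hu : Measurable fun q : Vec d × (Fin K → ℝ) =>
        (∑ a, 1 / pmin * |f a (q.1, q.2 a)|) ^ 3 :=
      (Finset.measurable_fun_sum _ fun a _ =>
        (((hf a).comp (by fun_prop)).abs.const_mul _)).pow_const 3
    have hid : ∫ ω, (∑ a, 1 / pmin * |f a (M.armPair a r ω)|) ^ 3 ∂μ
        = ∫ ω, (∑ a, 1 / pmin * |f a (M.armPair a t ω)|) ^ 3 ∂μ :=
      ((hM.identDistrib r t).comp hu).integral_eq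
    rw [hid]
    have hbi : Integrable (fun ω => (∑ a, 1 / pmin * |f a (M.armPair a t ω)|) ^ 3) μ := by
      have hL : MemLp (fun ω => ∑ a, 1 / pmin * |f a (M.armPair a t ω)|) 3 μ :=
        memLp_finsetSum _ fun a _ => MemLp.const_mul
          ((hM.memLp_armPair a t (hf a) (h a)).mono_exponent (by norm_num)).abs _
      refine (hL.integrable_norm_pow (p := 3) (by norm_num)).congr (ae_of_all _ fun ω => ?_)
      beta_reduce
      rw [Real.norm_of_nonneg (Finset.sum_nonneg fun a _ => by positivity)]
    refine integral_mono_of_nonneg (ae_of_all _ fun ω => by positivity) hbi ?_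
    have hall : ∀ᵐ ω ∂μ, ∀ a, M.weight a t ω ≤ 1 / pmin :=
      ae_all_iff.2 fun a => weight_le hp0 hpm a t
    filter_upwards [hall] with ω hω
    gcongr
    refine (Finset.abs_sum_le_sum_abs _ _).trans (Finset.sum_le_sum fun a _ => ?_)
    have := M.weight_mul_obsPair a t ω (f a)
    simp only [smul_eq_mul] at this
    rw [this, abs_mul, abs_of_nonneg (M.weight_nonneg a t ω)]
    gcongr
    exact hω a
  · have := tendsto_finsetSum Finset.univ fun a (_ : a ∈ Finset.univ) =>
      ((hM.tendsto_integral_abs_inv_sub_inv_mul hp0 hpm hconv r a ((hf a).pow_const 2)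
        (hsq a)).const_mul (1 / pmin))
    simpa using this
  · intro v t
    simp_rw [← hWh]
    push_cast
    simp_rw [Finset.mul_sum]
    rw [integral_finsetSum]
    · refine Finset.sum_eq_zero fun a _ => ?_
      have := hM.integral_history_mul_weight hp0 hpm r t a (hWm v t) (hf a)
      rw [hmean a] at this
      simpa using this
    · intro a _
      have := ((hw3 t a).integrable (by norm_num)).ofReal (𝕜 := ℂ)
      simpa using this.bdd_mul (hWhm v t) (ae_of_all _ (hWn v t))
  · intro v t
    simp_rw [← hWh, hdec]
    have hi1 : ∀ a, Integrable (fun ω => W v t (M.history t ω)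
        * ((M.weight a t ω * g a (M.obsPair t ω) : ℝ) : ℂ)) μ := fun a =>
      (hg1 t a).ofReal.bdd_mul (hWhm v t) (ae_of_all _ (hWn v t))
    have hi2 : ∀ a, Integrable (fun ω => W v t (M.history t ω) * ((E a t ω : ℝ) : ℂ)) μ := fun a =>
      (hEi a t).ofReal.bdd_mul (hWhm v t) (ae_of_all _ (hWn v t))
    have hsplit : ∫ ω, W v t (M.history t ω)
          * ((∑ a, (M.weight a t ω * g a (M.obsPair t ω) + E a t ω) : ℝ) : ℂ) ∂μ
        = ∑ a, (∫ ω, W v t (M.history t ω)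
            * ((M.weight a t ω * g a (M.obsPair t ω) : ℝ) : ℂ) ∂μ
          + ∫ ω, W v t (M.history t ω) * ((E a t ω : ℝ) : ℂ) ∂μ) := by
      have hpt : ∀ ω, W v t (M.history t ω)
          * ((∑ a, (M.weight a t ω * g a (M.obsPair t ω) + E a t ω) : ℝ) : ℂ)
          = ∑ a, (W v t (M.history t ω) * ((M.weight a t ω * g a (M.obsPair t ω) : ℝ) : ℂ)
            + W v t (M.history t ω) * ((E a t ω : ℝ) : ℂ)) := by
        intro ω
        push_cast
        rw [Finset.mul_sum]
        exact Finset.sum_congr rfl fun a _ => by ring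
      simp_rw [hpt]
      rw [integral_finsetSum]
      swap
      · exact fun a _ => (hi1 a).add (hi2 a)
      exact Finset.sum_congr rfl fun a _ => integral_add (hi1 a) (hi2 a)
    rw [hsplit, Finset.sum_add_distrib]
    have hfirst : ∑ a, ∫ ω, W v t (M.history t ω)
        * ((M.weight a t ω * g a (M.obsPair t ω) : ℝ) : ℂ) ∂μ
        = ((∑ a, ∫ ω, 1 / pibar.prob (M.X r ω) a * f a (M.armPair a r ω) ^ 2 ∂μ : ℝ) : ℂ)
          * ∫ ω, W v t (M.history t ω) ∂μ := by
      rw [Complex.ofReal_sum, Finset.sum_mul]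
      refine Finset.sum_congr rfl fun a _ => ?_
      have := hM.integral_history_mul_weight hp0 hpm r t a (hWm v t) (hgm a)
      refine this.trans ?_
      rw [mul_comm]
      rfl
    rw [hfirst, add_sub_cancel_left]
    refine (norm_sum_le _ _).trans (Finset.sum_le_sum fun a _ => ?_)
    refine le_trans ?_ (hE a t).2
    refine norm_integral_le_of_norm_le (hEi a t).abs (ae_of_all _ fun ω => ?_)
    rw [norm_mul, Complex.norm_real, Real.norm_eq_abs]
    exact mul_le_of_le_one_left (abs_nonneg _) (hWn v t ω)

end IsNoisyContextBandit

end Model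

/-! ### Moment identities of the measurement error model -/

/-- The pull-out and tower properties turn the conditional moment hypotheses into identities tested
against bounded functions. -/
theorem integral_mul_condExp {Ω : Type*} {m mΩ : MeasurableSpace Ω} {μ : Measure Ω}
    [IsFiniteMeasure μ] (hm : m ≤ mΩ) {φ g : Ω → ℝ} (hφ : StronglyMeasurable[m] φ)
    (hφb : MemLp φ ⊤ μ) (hg : Integrable g μ) :
    ∫ ω, φ ω * (μ[g | m]) ω ∂μ = ∫ ω, φ ω * g ω ∂μ := by
  have hint : Integrable (φ * g) μ :=
    memLp_one_iff_integrable.1 ((memLp_one_iff_integrable.2 hg).mul hφb)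
  have h := condExp_mul_of_stronglyMeasurable_left hφ hint hg
  calc ∫ ω, φ ω * (μ[g | m]) ω ∂μ = ∫ ω, (μ[φ * g | m]) ω ∂μ := (integral_congr_ae h).symm
    _ = ∫ ω, φ ω * g ω ∂μ := integral_condExp hm

theorem memLp_top_mul {Ω : Type*} {mΩ : MeasurableSpace Ω} {μ : Measure Ω} {f g : Ω → ℝ}
    {p : ENNReal} (hf : MemLp f ⊤ μ) (hg : MemLp g p μ) : MemLp (fun ω => f ω * g ω) p μ :=
  hg.mul hf

namespace Model

variable {d K : ℕ} {Ω : Type*}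

theorem score_apply (M : Model d K Ω) (x : Vec d) (y : ℝ) (θ : Vec d) (i : Fin d) :
    M.score x y θ i = y * x i - ∑ j, (outer x i j - M.SigmaE i j) * θ j := by
  simp [score, Matrix.mulVec, dotProduct]

theorem h_apply (M : Model d K Ω) (a : Fin K) (x s : Vec d) (i : Fin d) :
    M.h a x s i = ∑ j, (outer x i j - M.SigmaE i j) * M.theta a j
      - inner ℝ s (M.theta a) * x i := by
  simp [h, Matrix.mulVec, dotProduct]

theorem score_potentialOutcome (M : Model d K Ω) (a : Fin K) (t : ℕ) (ω : Ω) (i : Fin d) :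
    M.score (M.X t ω) (M.potentialOutcome t ω a) (M.theta a) i
      = M.X t ω i * M.eta t ω - M.h a (M.X t ω) (M.S t ω) i := by
  rw [score_apply, h_apply, potentialOutcome]
  ring

theorem outer_apply (x : Vec d) (i j : Fin d) : outer x i j = x i * x j := rfl

theorem measurable_outer (i j : Fin d) : Measurable fun x : Vec d => outer x i j := by
  simp_rw [outer_apply]
  fun_prop

theorem measurable_score (M : Model d K Ω) (θ : Vec d) (i : Fin d) :
    Measurable fun q : Vec d × ℝ => M.score q.1 q.2 θ i := by
  simp_rw [score_apply, outer_apply]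
  fun_prop

theorem measurable_h (M : Model d K Ω) (a : Fin K) (i : Fin d) :
    Measurable fun q : Vec d × Vec d => M.h a q.2 q.1 i := by
  simp_rw [h_apply, outer_apply]
  fun_prop

variable {mΩ : MeasurableSpace Ω} {μ : Measure Ω} {M : Model d K Ω}

theorem SigmaS_transpose (M : Model d K Ω) (μ : Measure Ω) (t : ℕ) :
    (M.SigmaS μ t)ᵀ = M.SigmaS μ t := by
  ext i j
  simp only [SigmaS, Matrix.transpose_apply, Matrix.of_apply, outer_apply, mul_comm]

namespace IsNoisyContextBandit

theorem sigmaS_le (hM : M.IsNoisyContextBandit μ) (t : ℕ) : M.sigmaS t ≤ mΩ :=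
  (hM.measurable_S t).comap_le

theorem sigmaSX_le (hM : M.IsNoisyContextBandit μ) (t : ℕ) : M.sigmaSX t ≤ mΩ :=
  ((hM.measurable_S t).prodMk (hM.measurable_X t)).comap_le

variable {pmin : ℝ} {pibar : StationaryPolicy d K}

theorem memLp_X (hM : M.IsNoisyContextBandit μ) (hreg : M.Regular μ) (t : ℕ) (i : Fin d) :
    MemLp (fun ω => M.X t ω i) ⊤ μ := by
  obtain ⟨C, hC⟩ := hreg.bounded
  have := hM.measurable_X t
  refine memLp_top_of_bound (by fun_prop) C ?_
  filter_upwards [hC t] with ω hω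
  exact (PiLp.norm_apply_le _ i).trans ((le_max_left _ _).trans hω)

theorem memLp_S (hM : M.IsNoisyContextBandit μ) (hreg : M.Regular μ) (t : ℕ) (i : Fin d) :
    MemLp (fun ω => M.S t ω i) ⊤ μ := by
  obtain ⟨C, hC⟩ := hreg.bounded
  have := hM.measurable_S t
  refine memLp_top_of_bound (by fun_prop) C ?_
  filter_upwards [hC t] with ω hω
  exact (PiLp.norm_apply_le _ i).trans ((le_max_right _ _).trans hω)

theorem memLp_eps (hM : M.IsNoisyContextBandit μ) (hreg : M.Regular μ) (t : ℕ) (i : Fin d) :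
    MemLp (fun ω => M.eps t ω i) ⊤ μ :=
  (hM.memLp_X hreg t i).sub (hM.memLp_S hreg t i)

theorem memLp_eta (hM : M.IsNoisyContextBandit μ) (hreg : M.Regular μ) (t : ℕ) :
    MemLp (M.eta t) 4 μ := by
  rw [← integrable_norm_rpow_iff (hM.measurable_eta t).aestronglyMeasurable (by norm_num)
    (by norm_num)]
  refine (hreg.integrable_eta t).congr (ae_of_all _ fun ω => ?_)
  have h4 : ((4 : ENNReal).toReal) = ((4 : ℕ) : ℝ) := by norm_num
  beta_reduce
  rw [h4, Real.rpow_natCast, Real.norm_eq_abs, Even.pow_abs (by decide)]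

theorem memLp_inv_pibar (hM : M.IsNoisyContextBandit μ) (hp0 : 0 < pmin)
    (hpm : ∀ t a, ∀ᵐ ω ∂μ, pmin ≤ M.selProb t a ω) (hconv : M.PolicyConverges μ pibar)
    (t : ℕ) (a : Fin K) : MemLp (fun ω => 1 / pibar.prob (M.X t ω) a) ⊤ μ := by
  refine memLp_top_of_bound ((hM.measurable_pibar t a).const_div 1).aestronglyMeasurable
    (1 / pmin) ?_
  filter_upwards [hM.le_pibar hpm hconv t a] with ω hω
  rw [Real.norm_of_nonneg (one_div_nonneg.2 (pibar.prob_nonneg _ _))]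
  exact one_div_le_one_div_of_le hp0 hω

variable [IsProbabilityMeasure μ]

theorem memLp_outer_sub (hM : M.IsNoisyContextBandit μ) (hreg : M.Regular μ) (t : ℕ)
    (i j : Fin d) : MemLp (fun ω => outer (M.X t ω) i j - M.SigmaE i j) ⊤ μ :=
  (memLp_top_mul (hM.memLp_X hreg t i) (hM.memLp_X hreg t j)).sub (memLp_const _)

theorem memLp_h (hM : M.IsNoisyContextBandit μ) (hreg : M.Regular μ) (a : Fin K) (t : ℕ)
    (i : Fin d) : MemLp (fun ω => M.h a (M.X t ω) (M.S t ω) i) ⊤ μ := by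
  have h1 : MemLp (fun ω => ∑ j, (outer (M.X t ω) i j - M.SigmaE i j) * M.theta a j) ⊤ μ :=
    memLp_finsetSum _ fun j _ => (hM.memLp_outer_sub hreg t i j).mul_const _
  have h2 : MemLp (fun ω => inner ℝ (M.S t ω) (M.theta a)) ⊤ μ := by
    simp_rw [PiLp.inner_apply]
    exact memLp_finsetSum _ fun j _ => (hM.memLp_S hreg t j).const_mul _
  simp_rw [h_apply]
  exact h1.sub (memLp_top_mul h2 (hM.memLp_X hreg t i))

theorem memLp_score (hM : M.IsNoisyContextBandit μ) (hreg : M.Regular μ) (a : Fin K) (t : ℕ)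
    (i : Fin d) :
    MemLp (fun ω => M.score (M.X t ω) (M.potentialOutcome t ω a) (M.theta a) i) 4 μ := by
  simp_rw [score_potentialOutcome]
  exact (memLp_top_mul (hM.memLp_X hreg t i) (hM.memLp_eta hreg t)).sub
    ((hM.memLp_h hreg a t i).mono_exponent le_top)

theorem integral_mul_eta (hM : M.IsNoisyContextBandit μ) (hreg : M.Regular μ) (t : ℕ)
    {φ : Vec d × Vec d → ℝ} (hφ : Measurable φ)
    (hb : MemLp (fun ω => φ (M.S t ω, M.X t ω)) ⊤ μ) :
    ∫ ω, φ (M.S t ω, M.X t ω) * M.eta t ω ∂μ = 0 := by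
  have hφm : StronglyMeasurable[M.sigmaSX t] fun ω => φ (M.S t ω, M.X t ω) :=
    (hφ.comp (comap_measurable fun ω => (M.S t ω, M.X t ω))).stronglyMeasurable
  rw [← integral_mul_condExp (hM.sigmaSX_le t) hφm hb
    ((hM.memLp_eta hreg t).integrable (by norm_num))]
  refine integral_eq_zero_of_ae ?_
  filter_upwards [hM.eta_mean t] with ω hω
  simp [hω]

theorem integral_mul_sigmaEtaSq (hM : M.IsNoisyContextBandit μ) (hreg : M.Regular μ) (t : ℕ)
    {φ : Vec d × Vec d → ℝ} (hφ : Measurable φ)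
    (hb : MemLp (fun ω => φ (M.S t ω, M.X t ω)) ⊤ μ) :
    ∫ ω, φ (M.S t ω, M.X t ω) * M.sigmaEtaSq μ t ω ∂μ
      = ∫ ω, φ (M.S t ω, M.X t ω) * M.eta t ω ^ 2 ∂μ := by
  have hφm : StronglyMeasurable[M.sigmaSX t] fun ω => φ (M.S t ω, M.X t ω) :=
    (hφ.comp (comap_measurable fun ω => (M.S t ω, M.X t ω))).stronglyMeasurable
  have h2 : Integrable (fun ω => M.eta t ω ^ 2) μ :=
    ((hM.memLp_eta hreg t).mono_exponent (by norm_num)).integrable_sq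
  rw [← integral_mul_condExp (hM.sigmaSX_le t) hφm hb h2]
  -- The conditional mean of η is zero, so the conditional variance is the conditional second
  -- moment.
  have hvar : M.sigmaEtaSq μ t =ᵐ[μ] μ[fun ω => M.eta t ω ^ 2 | M.sigmaSX t] := by
    refine condExp_congr_ae ?_
    filter_upwards [hM.eta_mean t] with ω hω
    simp [hω]
  refine integral_congr_ae ?_
  filter_upwards [hvar] with ω hω
  rw [hω]

theorem integrable_sigmaEtaSq (M : Model d K Ω) (μ : Measure Ω) (t : ℕ) :
    Integrable (M.sigmaEtaSq μ t) μ :=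
  integrable_condExp

theorem integral_S_mul_eps (hM : M.IsNoisyContextBandit μ) (hreg : M.Regular μ) (t : ℕ)
    (i j : Fin d) : ∫ ω, M.S t ω i * M.eps t ω j ∂μ = 0 := by
  have hm : StronglyMeasurable[M.sigmaS t] fun ω => M.S t ω i := by
    have h1 : Measurable fun s : Vec d => s i := by fun_prop
    exact (h1.comp (comap_measurable (M.S t))).stronglyMeasurable
  rw [← integral_mul_condExp (hM.sigmaS_le t) hm (hM.memLp_S hreg t i)
    ((hM.memLp_eps hreg t j).integrable le_top)]
  refine integral_eq_zero_of_ae ?_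
  filter_upwards [hM.eps_mean t j] with ω hω
  simp [hω]

theorem integral_eps_mul_eps (hM : M.IsNoisyContextBandit μ) (t : ℕ) (i j : Fin d) :
    ∫ ω, M.eps t ω i * M.eps t ω j ∂μ = M.SigmaE i j := by
  calc ∫ ω, M.eps t ω i * M.eps t ω j ∂μ
      = ∫ ω, (μ[fun ω => outer (M.eps t ω) i j | M.sigmaS t]) ω ∂μ :=
        (integral_condExp (hM.sigmaS_le t)).symm
    _ = M.SigmaE i j := by
        rw [integral_congr_ae (hM.eps_var t i j)]
        simp

theorem integral_X_mul_S (hM : M.IsNoisyContextBandit μ) (hreg : M.Regular μ) (t : ℕ)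
    (i j : Fin d) : ∫ ω, M.X t ω i * M.S t ω j ∂μ = M.SigmaS μ t i j := by
  have h : ∀ ω, M.X t ω i * M.S t ω j = outer (M.S t ω) i j + M.S t ω j * M.eps t ω i := by
    intro ω
    simp only [outer_apply, eps, PiLp.sub_apply]
    ring
  simp_rw [h]
  rw [integral_add, hM.integral_S_mul_eps hreg, add_zero]
  · rfl
  · exact (memLp_top_mul (hM.memLp_S hreg t i) (hM.memLp_S hreg t j)).integrable le_top
  · exact (memLp_top_mul (hM.memLp_S hreg t j) (hM.memLp_eps hreg t i)).integrable le_top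

/-- With X = S + ε and ε uncorrelated with S, the noise inflates the second moment of X by exactly
Σ_e. In particular Σ_S is determined by the law of X and does not depend on the round, although the
S_t are not assumed identically distributed. -/
theorem integral_outer_X_sub (hM : M.IsNoisyContextBandit μ) (hreg : M.Regular μ) (t : ℕ)
    (i j : Fin d) :
    ∫ ω, (outer (M.X t ω) i j - M.SigmaE i j) ∂μ = M.SigmaS μ t i j := by
  have h : ∀ ω, outer (M.X t ω) i j
      = M.X t ω i * M.S t ω j + (M.S t ω i * M.eps t ω j + M.eps t ω i * M.eps t ω j) := by
    intro ω
    simp only [outer_apply, eps, PiLp.sub_apply]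
    ring
  have h1 := (memLp_top_mul (hM.memLp_X hreg t i) (hM.memLp_S hreg t j)).integrable le_top
  have h2 := (memLp_top_mul (hM.memLp_S hreg t i) (hM.memLp_eps hreg t j)).integrable le_top
  have h3 := (memLp_top_mul (hM.memLp_eps hreg t i) (hM.memLp_eps hreg t j)).integrable le_top
  have h4 : Integrable (fun ω => outer (M.X t ω) i j) μ :=
    (memLp_top_mul (hM.memLp_X hreg t i) (hM.memLp_X hreg t j)).integrable le_top
  rw [integral_sub h4 (integrable_const _)]
  have h23 : Integrable (fun ω => M.S t ω i * M.eps t ω j + M.eps t ω i * M.eps t ω j) μ :=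
    h2.add h3
  simp_rw [h]
  rw [integral_add h1 h23, integral_add h2 h3, hM.integral_X_mul_S hreg,
    hM.integral_S_mul_eps hreg, hM.integral_eps_mul_eps]
  simp

/-- Unbiasedness at the truth: E[X η] = 0, and both E[X Sᵀ] and E[X Xᵀ] − Σ_e equal Σ_S, so the two
terms in θ_a^* cancel. -/
theorem integral_score (hM : M.IsNoisyContextBandit μ) (hreg : M.Regular μ) (a : Fin K) (t : ℕ)
    (i : Fin d) :
    ∫ ω, M.score (M.X t ω) (M.potentialOutcome t ω a) (M.theta a) i ∂μ = 0 := by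
  have h : ∀ ω, M.score (M.X t ω) (M.potentialOutcome t ω a) (M.theta a) i
      = M.X t ω i * M.eta t ω + ∑ j, (M.X t ω i * M.S t ω j * M.theta a j
        - (outer (M.X t ω) i j - M.SigmaE i j) * M.theta a j) := by
    intro ω
    rw [score_apply, potentialOutcome, PiLp.inner_apply, Finset.sum_sub_distrib]
    have : ∑ j, M.X t ω i * M.S t ω j * M.theta a j
        = M.X t ω i * ∑ j, inner ℝ (M.S t ω j) (M.theta a j) := by
      rw [Finset.mul_sum]
      refine Finset.sum_congr rfl fun j _ => ?_
      rw [real_inner_eq_re_inner, RCLike.inner_apply]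
      simp
      ring
    rw [this]
    ring
  have h1 : Integrable (fun ω => M.X t ω i * M.eta t ω) μ :=
    (memLp_top_mul (hM.memLp_X hreg t i) (hM.memLp_eta hreg t)).integrable (by norm_num)
  have h2 : ∀ j, Integrable (fun ω => M.X t ω i * M.S t ω j * M.theta a j) μ := fun j =>
    ((memLp_top_mul (hM.memLp_X hreg t i) (hM.memLp_S hreg t j)).integrable le_top).mul_const _
  have h3 : ∀ j, Integrable
      (fun ω => (outer (M.X t ω) i j - M.SigmaE i j) * M.theta a j) μ := fun j =>
    ((hM.memLp_outer_sub hreg t i j).integrable le_top).mul_const _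
  have h23 : ∀ j ∈ Finset.univ, Integrable (fun ω => M.X t ω i * M.S t ω j * M.theta a j
      - (outer (M.X t ω) i j - M.SigmaE i j) * M.theta a j) μ := fun j _ => (h2 j).sub (h3 j)
  have heta := hM.integral_mul_eta hreg t (φ := fun q => q.2 i) (by fun_prop)
    (hM.memLp_X hreg t i)
  simp_rw [h]
  rw [integral_add h1 (integrable_finsetSum _ h23), heta, integral_finsetSum _ h23, zero_add]
  refine Finset.sum_eq_zero fun j _ => ?_
  rw [integral_sub (h2 j) (h3 j), integral_mul_const, integral_mul_const,
    hM.integral_X_mul_S hreg, hM.integral_outer_X_sub hreg, sub_self]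

/-- The limiting matrix `Ibar_a` is the weighted second moment of the score at `θ_a^*`. -/
theorem Ibar_apply (hM : M.IsNoisyContextBandit μ) (hreg : M.Regular μ) (hp0 : 0 < pmin)
    (hpm : ∀ t a, ∀ᵐ ω ∂μ, pmin ≤ M.selProb t a ω) (hconv : M.PolicyConverges μ pibar)
    (t : ℕ) (a : Fin K) (i j : Fin d) :
    M.Ibar μ pibar t a i j = ∫ ω, 1 / pibar.prob (M.X t ω) a
      * (M.score (M.X t ω) (M.potentialOutcome t ω a) (M.theta a) i
        * M.score (M.X t ω) (M.potentialOutcome t ω a) (M.theta a) j) ∂μ := by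
  have hP := hM.memLp_inv_pibar hp0 hpm hconv t a
  have hh := fun i => hM.memLp_h hreg a t i
  have hX := fun i => hM.memLp_X hreg t i
  have hη := hM.memLp_eta hreg t
  have hη2 : MemLp (fun ω => M.eta t ω ^ 2) 2 μ := by
    simp_rw [sq]
    exact memLp_two_mul_of_memLp_four hη hη
  have hpm' : Measurable fun q : Vec d × Vec d => 1 / pibar.prob q.2 a :=
    ((pibar.measurable_prob a).comp measurable_snd).const_div 1
  have hXm : ∀ i, Measurable fun q : Vec d × Vec d => q.2 i := fun i => by fun_prop
  have hb1 : MemLp (fun ω => 1 / pibar.prob (M.X t ω) a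
      * outer (M.h a (M.X t ω) (M.S t ω)) i j) ⊤ μ :=
    memLp_top_mul hP (memLp_top_mul (hh i) (hh j))
  have hb2 : MemLp (fun ω => 1 / pibar.prob (M.X t ω) a * outer (M.X t ω) i j) ⊤ μ :=
    memLp_top_mul hP (memLp_top_mul (hX i) (hX j))
  have hb3 : MemLp (fun ω => 1 / pibar.prob (M.X t ω) a
      * (M.X t ω i * M.h a (M.X t ω) (M.S t ω) j + M.X t ω j * M.h a (M.X t ω) (M.S t ω) i))
      ⊤ μ :=
    memLp_top_mul hP ((memLp_top_mul (hX i) (hh j)).add (memLp_top_mul (hX j) (hh i)))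
  -- The score is X η − h. The cross terms of its outer product are linear in η and vanish because
  -- E[η | S, X] = 0.
  have hz := hM.integral_mul_eta hreg t (φ := fun q => 1 / pibar.prob q.2 a
    * (q.2 i * M.h a q.2 q.1 j + q.2 j * M.h a q.2 q.1 i))
    (hpm'.mul (((hXm i).mul (M.measurable_h a j)).add ((hXm j).mul (M.measurable_h a i)))) hb3
  have hv := hM.integral_mul_sigmaEtaSq hreg t
    (φ := fun q => 1 / pibar.prob q.2 a * outer q.2 i j)
    (hpm'.mul ((measurable_outer i j).comp measurable_snd)) hb2
  have hi1 := hb1.integrable le_top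
  have hi2 : Integrable (fun ω => 1 / pibar.prob (M.X t ω) a * outer (M.X t ω) i j
      * M.sigmaEtaSq μ t ω) μ :=
    memLp_one_iff_integrable.1 (memLp_top_mul hb2
      (memLp_one_iff_integrable.2 (integrable_sigmaEtaSq M μ t)))
  have hi3 : Integrable (fun ω => 1 / pibar.prob (M.X t ω) a * outer (M.X t ω) i j
      * M.eta t ω ^ 2) μ := (memLp_top_mul hb2 hη2).integrable (by norm_num)
  have hi4 : Integrable (fun ω => 1 / pibar.prob (M.X t ω) a
      * (M.X t ω i * M.h a (M.X t ω) (M.S t ω) j + M.X t ω j * M.h a (M.X t ω) (M.S t ω) i)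
      * M.eta t ω) μ := (memLp_top_mul hb3 hη).integrable (by norm_num)
  have hL : M.Ibar μ pibar t a i j
      = ∫ ω, (1 / pibar.prob (M.X t ω) a * outer (M.h a (M.X t ω) (M.S t ω)) i j
        + 1 / pibar.prob (M.X t ω) a * outer (M.X t ω) i j * M.sigmaEtaSq μ t ω) ∂μ := by
    simp only [Ibar, Matrix.of_apply]
    congr 1
    ext ω
    ring
  have hR : ∀ ω, 1 / pibar.prob (M.X t ω) a
      * (M.score (M.X t ω) (M.potentialOutcome t ω a) (M.theta a) i
        * M.score (M.X t ω) (M.potentialOutcome t ω a) (M.theta a) j)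
      = 1 / pibar.prob (M.X t ω) a * outer (M.h a (M.X t ω) (M.S t ω)) i j
        + 1 / pibar.prob (M.X t ω) a * outer (M.X t ω) i j * M.eta t ω ^ 2
        - 1 / pibar.prob (M.X t ω) a
          * (M.X t ω i * M.h a (M.X t ω) (M.S t ω) j + M.X t ω j * M.h a (M.X t ω) (M.S t ω) i)
          * M.eta t ω := by
    intro ω
    rw [score_potentialOutcome, score_potentialOutcome, outer_apply, outer_apply]
    ring
  have hi13 : Integrable (fun ω => 1 / pibar.prob (M.X t ω) a
      * outer (M.h a (M.X t ω) (M.S t ω)) i j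
      + 1 / pibar.prob (M.X t ω) a * outer (M.X t ω) i j * M.eta t ω ^ 2) μ := hi1.add hi3
  simp_rw [hR]
  rw [hL, integral_add hi1 hi2, integral_sub hi13 hi4, integral_add hi1 hi3, hz, sub_zero]
  congr 1

theorem tendstoInMeasure_Gdot (hM : M.IsNoisyContextBandit μ) (hreg : M.Regular μ)
    (hp0 : 0 < pmin) (hpm : ∀ t a, ∀ᵐ ω ∂μ, pmin ≤ M.selProb t a ω) (r : ℕ) (a : Fin K)
    (i j : Fin d) :
    TendstoInMeasure μ (fun T ω => M.Gdot a T ω i j) atTop (fun _ => M.SigmaS μ r i j) := by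
  have h := hM.tendstoInMeasure_average_weight hp0 hpm r a
    (f := fun q => outer q.1 i j - M.SigmaE i j)
    (((measurable_outer i j).comp measurable_fst).sub_const _)
    ((hM.memLp_outer_sub hreg r i j).mono_exponent le_top)
  have hlim : ∫ ω, (outer (M.armPair a r ω).1 i j - M.SigmaE i j) ∂μ = M.SigmaS μ r i j :=
    hM.integral_outer_X_sub hreg r i j
  rw [hlim] at h
  refine h.congr_left fun T => ae_of_all _ fun ω => ?_
  simp [Gdot, Matrix.sum_apply, obsPair]

theorem G_apply (M : Model d K Ω) (a : Fin K) (T : ℕ) (θ : Vec d) (ω : Ω) (i : Fin d) :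
    M.G a T θ ω i = (1 / (T : ℝ)) * ∑ t ∈ Finset.range T,
      M.weight a t ω * M.score (M.obsPair t ω).1 (M.obsPair t ω).2 θ i := by
  simp [G, obsPair]

theorem tendstoInMeasure_G (hM : M.IsNoisyContextBandit μ) (hreg : M.Regular μ)
    (hp0 : 0 < pmin) (hpm : ∀ t a, ∀ᵐ ω ∂μ, pmin ≤ M.selProb t a ω) (a : Fin K) (i : Fin d) :
    TendstoInMeasure μ (fun T ω => M.G a T (M.theta a) ω i) atTop (fun _ => 0) := by
  have h := hM.tendstoInMeasure_average_weight hp0 hpm 0 a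
    (f := fun q => M.score q.1 q.2 (M.theta a) i) (M.measurable_score _ i)
    ((hM.memLp_score hreg a 0 i).mono_exponent (by norm_num))
  have hlim : ∫ ω, M.score (M.armPair a 0 ω).1 (M.armPair a 0 ω).2 (M.theta a) i ∂μ = 0 :=
    hM.integral_score hreg a 0 i
  rw [hlim] at h
  exact h.congr_left fun T => ae_of_all _ fun ω => (G_apply M a T _ ω i).symm

end IsNoisyContextBandit

end Model

/-! ### Matrix inversion and linear images of Gaussians -/

section MatrixLemmas

theorem continuousAt_matrix_inv {n : Type*} [Fintype n] [DecidableEq n] {A : Matrix n n ℝ}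
    (hA : IsUnit A.det) : ContinuousAt (fun B : Matrix n n ℝ => B⁻¹) A := by
  simp_rw [Matrix.inv_def, Ring.inverse_eq_inv]
  refine ContinuousAt.smul (ContinuousAt.inv₀ ?_ hA.ne_zero) ?_
  · exact (Continuous.matrix_det continuous_id).continuousAt
  · exact (Continuous.matrix_adjugate continuous_id).continuousAt

theorem continuousAt_matrix_inv_apply {n : Type*} [Fintype n] [DecidableEq n] {A : Matrix n n ℝ}
    (hA : IsUnit A.det) (i j : n) :
    ContinuousAt (fun B : n → n → ℝ => (Matrix.of B)⁻¹ i j) (fun i j => A i j) := by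
  have h : ContinuousAt (fun B : Matrix n n ℝ => B⁻¹ i j) A :=
    ((Continuous.matrix_elem continuous_id i j).continuousAt
      (x := A⁻¹)).comp (continuousAt_matrix_inv hA)
  exact h

/-- The formula det⁻¹ · adjugate holds for every matrix under 0⁻¹ = 0, which matches the convention
for singular matrices. -/
theorem measurable_matrix_inv_apply {n Ω : Type*} [Fintype n] [DecidableEq n] [MeasurableSpace Ω]
    {A : Ω → Matrix n n ℝ} (hA : ∀ i j, Measurable fun ω => A ω i j) (i j : n) :
    Measurable fun ω => (A ω)⁻¹ i j := by
  have hA' : Measurable fun ω i j => A ω i j :=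
    measurable_pi_lambda _ fun i => measurable_pi_lambda _ fun j => hA i j
  have hcont : Continuous fun B : n → n → ℝ => Matrix.of B := continuous_id
  have h1 : Measurable fun B : n → n → ℝ => (Matrix.of B).det :=
    (Continuous.matrix_det hcont).measurable
  have h2 : Measurable fun B : n → n → ℝ => (Matrix.of B).adjugate i j :=
    ((Continuous.matrix_adjugate hcont).matrix_elem i j).measurable
  have h3 : Measurable fun B : n → n → ℝ => (Matrix.of B)⁻¹ i j := by
    simp_rw [Matrix.inv_def, Ring.inverse_eq_inv, Matrix.smul_apply, smul_eq_mul]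
    exact h1.inv.mul h2
  exact h3.comp hA'

theorem blockDiagonal_mulVec_apply {m o : Type*} [Fintype m] [Fintype o] [DecidableEq o]
    (B : o → Matrix m m ℝ) (v : m × o → ℝ) (p : m × o) :
    (Matrix.blockDiagonal B *ᵥ v) p = ∑ j, B p.2 p.1 j * v (j, p.2) := by
  obtain ⟨i, k⟩ := p
  simp [Matrix.mulVec, dotProduct, Fintype.sum_prod_type, Matrix.blockDiagonal_apply]

/-- The image of a centered Gaussian under a linear map. -/
theorem map_multivariateGaussian_mulVec {n : Type*} [Fintype n] [DecidableEq n]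
    {S : Matrix n n ℝ} (hS : S.PosSemidef) (B : Matrix n n ℝ) :
    (multivariateGaussian 0 S).map
        (fun z : EuclideanSpace ℝ n => (WithLp.toLp 2 (B *ᵥ z.ofLp) : EuclideanSpace ℝ n))
      = multivariateGaussian 0 (B * S * Bᵀ) := by
  have hcont : Continuous
      fun z : EuclideanSpace ℝ n => (WithLp.toLp 2 (B *ᵥ z.ofLp) : EuclideanSpace ℝ n) := by
    refine (PiLp.continuous_toLp 2 _).comp ?_
    exact Continuous.matrix_mulVec continuous_const (PiLp.continuous_ofLp 2 _)
  have := Measure.isProbabilityMeasure_map (μ := multivariateGaussian (0 : EuclideanSpace ℝ n) S)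
    hcont.measurable.aemeasurable
  have hBS : (B * S * Bᵀ).PosSemidef := by
    have := hS.mul_mul_conjTranspose_same B
    rwa [Matrix.conjTranspose_eq_transpose_of_trivial] at this
  refine Measure.ext_of_charFun ?_
  ext u
  have hinner : ∀ z : EuclideanSpace ℝ n,
      inner ℝ (WithLp.toLp 2 (B *ᵥ z.ofLp) : EuclideanSpace ℝ n) u
        = inner ℝ z (WithLp.toLp 2 (Bᵀ *ᵥ u.ofLp) : EuclideanSpace ℝ n) := by
    intro z
    rw [EuclideanSpace.inner_eq_star_dotProduct, EuclideanSpace.inner_eq_star_dotProduct]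
    simp only [star_trivial]
    rw [Matrix.dotProduct_mulVec, ← Matrix.mulVec_transpose]
  rw [charFun_apply, integral_map hcont.measurable.aemeasurable
    (Measurable.aestronglyMeasurable (by fun_prop))]
  simp_rw [hinner]
  rw [← charFun_apply, charFun_multivariateGaussian hS, charFun_multivariateGaussian hBS]
  have hq : (Bᵀ *ᵥ u.ofLp) ⬝ᵥ S *ᵥ (Bᵀ *ᵥ u.ofLp) = u.ofLp ⬝ᵥ (B * S * Bᵀ) *ᵥ u.ofLp := by
    rw [← Matrix.mulVec_mulVec, ← Matrix.mulVec_mulVec, Matrix.dotProduct_mulVec u.ofLp B,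
      ← Matrix.mulVec_transpose]
  simp only [inner_zero_right]
  rw [hq]

end MatrixLemmas

/-! ### The affine estimating equation and the limit of the score -/

namespace Model

variable {d K : ℕ} {Ω : Type*} {mΩ : MeasurableSpace Ω} {μ : Measure Ω} {M : Model d K Ω}

theorem G_ofLp (M : Model d K Ω) (a : Fin K) (T : ℕ) (θ : Vec d) (ω : Ω) :
    (M.G a T θ ω).ofLp = (1 / (T : ℝ)) • ∑ t ∈ Finset.range T,
      M.weight a t ω • (M.Y t ω • (M.X t ω).ofLp) - M.Gdot a T ω *ᵥ θ.ofLp := by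
  simp only [G, score, WithLp.ofLp_smul, WithLp.ofLp_sum, WithLp.ofLp_sub, smul_sub,
    Finset.sum_sub_distrib]
  simp only [Gdot, Matrix.smul_mulVec, Matrix.sum_mulVec]

/-- G is affine in θ, so the difference of its values at two parameters is `Gdot` applied to their
difference. -/
theorem sub_eq_inv_mulVec (M : Model d K Ω) {a : Fin K} {T : ℕ} {ω : Ω}
    (hG : IsUnit (M.Gdot a T ω).det) (θ θ' : Vec d) :
    θ'.ofLp - θ.ofLp = (M.Gdot a T ω)⁻¹ *ᵥ ((M.G a T θ ω).ofLp - (M.G a T θ' ω).ofLp) := by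
  rw [G_ofLp, G_ofLp, sub_sub_sub_cancel_left, ← Matrix.mulVec_sub, Matrix.mulVec_mulVec,
    Matrix.nonsing_inv_mul _ hG, Matrix.one_mulVec]

theorem G_ipwEstimator (M : Model d K Ω) {a : Fin K} {T : ℕ} {ω : Ω}
    (hG : IsUnit (M.Gdot a T ω).det) : M.G a T (M.ipwEstimator T a ω) ω = 0 := by
  apply WithLp.ofLp_injective
  rw [G_ofLp]
  simp only [ipwEstimator]
  rw [Matrix.mulVec_mulVec, Matrix.mul_nonsing_inv _ hG, Matrix.one_mulVec, sub_self,
    WithLp.ofLp_zero]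

/-- The event on which one of the matrices `Gdot` is singular. -/
def singularEvent (M : Model d K Ω) (T : ℕ) : Set Ω := ⋃ a, {ω | ¬ IsUnit (M.Gdot a T ω).det}

/-- The stacked, rescaled estimating functions at the true parameter. -/
def stackedScore (M : Model d K Ω) (T : ℕ) (ω : Ω) :
    EuclideanSpace ℝ (Fin d × Fin K) :=
  WithLp.toLp 2 fun p => √(T : ℝ) * M.G p.2 T (M.theta p.2) ω p.1

theorem isUnit_of_notMem_singularEvent {T : ℕ} {ω : Ω} (h : ω ∉ M.singularEvent T) (a : Fin K) :
    IsUnit (M.Gdot a T ω).det := by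
  by_contra hn
  exact h (Set.mem_iUnion.2 ⟨a, hn⟩)

namespace IsNoisyContextBandit

theorem measurable_Gdot_apply (hM : M.IsNoisyContextBandit μ) (a : Fin K) (T : ℕ) (i j : Fin d) :
    Measurable fun ω => M.Gdot a T ω i j := by
  have h : ∀ ω, M.Gdot a T ω i j = (1 / (T : ℝ)) * ∑ t ∈ Finset.range T,
      M.weight a t ω * (outer (M.X t ω) i j - M.SigmaE i j) := by
    intro ω
    simp [Gdot, Matrix.sum_apply]
  simp_rw [h]
  refine (Finset.measurable_fun_sum _ fun t _ => (hM.measurable_weight a t).mul ?_).const_mul _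
  exact ((measurable_outer i j).comp (hM.measurable_X t)).sub_const _

theorem measurable_average_weight_Y_X (hM : M.IsNoisyContextBandit μ) (a : Fin K) (T : ℕ)
    (i : Fin d) : Measurable fun ω => ((1 / (T : ℝ)) • ∑ t ∈ Finset.range T,
      M.weight a t ω • (M.Y t ω • (M.X t ω).ofLp)) i := by
  simp only [Pi.smul_apply, Finset.sum_apply, smul_eq_mul]
  refine (Finset.measurable_fun_sum _ fun t _ => (hM.measurable_weight a t).mul
    ((hM.measurable_Y t).mul ?_)).const_mul _
  have := hM.measurable_X t
  fun_prop

theorem aemeasurable_G_apply (hM : M.IsNoisyContextBandit μ) (a : Fin K) (T : ℕ)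
    {θ : Ω → Vec d} (hθ : AEMeasurable θ μ) (i : Fin d) :
    AEMeasurable (fun ω => M.G a T (θ ω) ω i) μ := by
  simp_rw [G_ofLp, Pi.sub_apply, Matrix.mulVec, dotProduct]
  refine (hM.measurable_average_weight_Y_X a T i).aemeasurable.sub
    (Finset.aemeasurable_fun_sum _ fun j _ => ?_)
  exact (hM.measurable_Gdot_apply a T i j).aemeasurable.mul (by fun_prop)

theorem measurable_ipwEstimator (hM : M.IsNoisyContextBandit μ) (T : ℕ) (a : Fin K) :
    Measurable (M.ipwEstimator T a) := by
  refine (WithLp.measurable_toLp 2 _).comp (measurable_pi_lambda _ fun i => ?_)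
  simp only [Matrix.mulVec, dotProduct]
  exact Finset.measurable_fun_sum _ fun j _ =>
    (measurable_matrix_inv_apply (hM.measurable_Gdot_apply a T) i j).mul
      (hM.measurable_average_weight_Y_X a T j)

theorem isUnit_det_SigmaS (hreg : M.Regular μ) (r : ℕ) : IsUnit (M.SigmaS μ r).det :=
  (Matrix.isUnit_iff_isUnit_det _).1 (hreg.isUnit_SigmaS r)

theorem aemeasurable_stackedScore (hM : M.IsNoisyContextBandit μ) (T : ℕ) :
    AEMeasurable (M.stackedScore T) μ := by
  refine (WithLp.measurable_toLp 2 _).comp_aemeasurable (aemeasurable_pi_lambda _ fun p => ?_)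
  exact (hM.aemeasurable_G_apply p.2 T aemeasurable_const p.1).const_mul _

variable [IsProbabilityMeasure μ] {pmin : ℝ} {pibar : StationaryPolicy d K}

theorem tendstoInMeasure_Gdot_pi (hM : M.IsNoisyContextBandit μ) (hreg : M.Regular μ)
    (hp0 : 0 < pmin) (hpm : ∀ t a, ∀ᵐ ω ∂μ, pmin ≤ M.selProb t a ω) (r : ℕ) (a : Fin K) :
    TendstoInMeasure μ (fun T ω (i j : Fin d) => M.Gdot a T ω i j) atTop
      (fun _ i j => M.SigmaS μ r i j) :=
  TendstoInMeasure.pi fun i => TendstoInMeasure.pi fun j =>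
    hM.tendstoInMeasure_Gdot hreg hp0 hpm r a i j

/-- The nonvanishing of the determinant is an open condition satisfied by Σ_S, the limit of every
`Gdot`. -/
theorem tendsto_measure_singularEvent (hM : M.IsNoisyContextBandit μ) (hreg : M.Regular μ)
    (hp0 : 0 < pmin) (hpm : ∀ t a, ∀ᵐ ω ∂μ, pmin ≤ M.selProb t a ω) :
    Tendsto (fun T => μ (M.singularEvent T)) atTop (𝓝 0) := by
  have hone : ∀ a, Tendsto (fun T => μ {ω | ¬ IsUnit (M.Gdot a T ω).det}) atTop (𝓝 0) := by
    intro a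
    have hcont : Continuous fun B : Fin d → Fin d → ℝ => (Matrix.of B).det :=
      Continuous.matrix_det continuous_id
    have hopen : IsOpen {B : Fin d → Fin d → ℝ | (Matrix.of B).det ≠ 0} :=
      isOpen_ne_fun hcont continuous_const
    have hmem : (fun i j => M.SigmaS μ 0 i j) ∈ {B : Fin d → Fin d → ℝ | (Matrix.of B).det ≠ 0} :=
      (isUnit_det_SigmaS hreg 0).ne_zero
    refine tendsto_measure_of_subset (fun T ω hω => ?_) (tendstoInMeasure_const_iff.1
      (hM.tendstoInMeasure_Gdot_pi hreg hp0 hpm 0 a) _ (hopen.mem_nhds hmem))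
    intro hn
    exact hω (isUnit_iff_ne_zero.2 hn)
  have hsum : Tendsto (fun T => ∑ a, μ {ω | ¬ IsUnit (M.Gdot a T ω).det}) atTop (𝓝 0) := by
    simpa using tendsto_finsetSum Finset.univ fun a _ => hone a
  exact tendsto_of_tendsto_of_tendsto_of_le_of_le tendsto_const_nhds hsum
    (fun _ => zero_le) fun T => measure_iUnion_fintype_le μ _

theorem tendstoInMeasure_Gdot_inv (hM : M.IsNoisyContextBandit μ) (hreg : M.Regular μ)
    (hp0 : 0 < pmin) (hpm : ∀ t a, ∀ᵐ ω ∂μ, pmin ≤ M.selProb t a ω) (r : ℕ) (a : Fin K)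
    (i j : Fin d) :
    TendstoInMeasure μ (fun T ω => (M.Gdot a T ω)⁻¹ i j) atTop
      (fun _ => (M.SigmaS μ r)⁻¹ i j) := by
  have h := TendstoInMeasure.comp_continuousAt (hM.tendstoInMeasure_Gdot_pi hreg hp0 hpm r a)
    (g := fun B : Fin d → Fin d → ℝ => (Matrix.of B)⁻¹ i j)
    (continuousAt_matrix_inv_apply (isUnit_det_SigmaS hreg r) i j)
  exact h

/-- Off the singular event the estimator solves the equation exactly, so whatever value is assigned
to a singular inverse is irrelevant. -/
theorem isIPWZEstimator_ipwEstimator (hM : M.IsNoisyContextBandit μ) (hreg : M.Regular μ)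
    (hp0 : 0 < pmin) (hpm : ∀ t a, ∀ᵐ ω ∂μ, pmin ≤ M.selProb t a ω) :
    M.IsIPWZEstimator μ M.ipwEstimator where
  aemeasurable T a := (hM.measurable_ipwEstimator T a).aemeasurable
  estimating_equation a := by
    refine TendstoInMeasure.congr_of_measure_ne (tendstoInMeasure_const 0)
      (hM.tendsto_measure_singularEvent hreg hp0 hpm) fun T ω hω => ?_
    rw [M.G_ipwEstimator (isUnit_of_notMem_singularEvent hω a), smul_zero]

/-- The quadratic form of the limiting block diagonal matrix. -/
theorem dotProduct_blockDiagonal_Ibar (hM : M.IsNoisyContextBandit μ) (hreg : M.Regular μ)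
    (hp0 : 0 < pmin) (hpm : ∀ t a, ∀ᵐ ω ∂μ, pmin ≤ M.selProb t a ω)
    (hconv : M.PolicyConverges μ pibar) (r : ℕ) (u : Fin d × Fin K → ℝ) :
    u ⬝ᵥ Matrix.blockDiagonal (M.Ibar μ pibar r) *ᵥ u
      = ∑ a, ∫ ω, 1 / pibar.prob (M.X r ω) a
        * (∑ i, u (i, a) * M.score (M.X r ω) (M.potentialOutcome r ω a) (M.theta a) i) ^ 2 ∂μ := by
  have hint : ∀ a i j, Integrable (fun ω => 1 / pibar.prob (M.X r ω) a
      * (M.score (M.X r ω) (M.potentialOutcome r ω a) (M.theta a) i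
        * M.score (M.X r ω) (M.potentialOutcome r ω a) (M.theta a) j)) μ := fun a i j =>
    (memLp_top_mul (hM.memLp_inv_pibar hp0 hpm hconv r a) (memLp_two_mul_of_memLp_four
      (hM.memLp_score hreg a r i) (hM.memLp_score hreg a r j))).integrable (by norm_num)
  simp only [dotProduct, blockDiagonal_mulVec_apply]
  rw [Fintype.sum_prod_type_right]
  refine Finset.sum_congr rfl fun a _ => ?_
  have hexp : ∀ ω, 1 / pibar.prob (M.X r ω) a
      * (∑ i, u (i, a) * M.score (M.X r ω) (M.potentialOutcome r ω a) (M.theta a) i) ^ 2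
      = ∑ i, ∑ j, u (i, a) * u (j, a) * (1 / pibar.prob (M.X r ω) a
        * (M.score (M.X r ω) (M.potentialOutcome r ω a) (M.theta a) i
          * M.score (M.X r ω) (M.potentialOutcome r ω a) (M.theta a) j)) := by
    intro ω
    rw [sq, Finset.sum_mul_sum, Finset.mul_sum]
    refine Finset.sum_congr rfl fun i _ => ?_
    rw [Finset.mul_sum]
    exact Finset.sum_congr rfl fun j _ => by ring
  simp_rw [hexp]
  rw [integral_finsetSum _ fun i _ => integrable_finsetSum _ fun j _ => (hint a i j).const_mul _]
  refine Finset.sum_congr rfl fun i _ => ?_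
  rw [integral_finsetSum _ fun j _ => (hint a i j).const_mul _, Finset.mul_sum]
  refine Finset.sum_congr rfl fun j _ => ?_
  rw [integral_const_mul, ← hM.Ibar_apply hreg hp0 hpm hconv r a i j]
  ring

theorem posSemidef_blockDiagonal_Ibar (hM : M.IsNoisyContextBandit μ) (hreg : M.Regular μ)
    (hp0 : 0 < pmin) (hpm : ∀ t a, ∀ᵐ ω ∂μ, pmin ≤ M.selProb t a ω)
    (hconv : M.PolicyConverges μ pibar) (r : ℕ) :
    (Matrix.blockDiagonal (M.Ibar μ pibar r)).PosSemidef := by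
  refine Matrix.PosSemidef.of_dotProduct_mulVec_nonneg ?_ fun u => ?_
  · rw [Matrix.IsHermitian, Matrix.conjTranspose_eq_transpose_of_trivial,
      Matrix.blockDiagonal_transpose]
    congr 1
    ext a i j
    rw [Matrix.transpose_apply, hM.Ibar_apply hreg hp0 hpm hconv,
      hM.Ibar_apply hreg hp0 hpm hconv]
    simp_rw [mul_comm (M.score _ _ _ j)]
  · rw [star_trivial, hM.dotProduct_blockDiagonal_Ibar hreg hp0 hpm hconv]
    refine Finset.sum_nonneg fun a _ => integral_nonneg fun ω => ?_
    exact mul_nonneg (one_div_nonneg.2 (pibar.prob_nonneg _ _)) (sq_nonneg _)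

theorem blockDiagonal_SigmaStar (M : Model d K Ω) (μ : Measure Ω) (pibar : StationaryPolicy d K)
    (r : ℕ) :
    Matrix.blockDiagonal (M.SigmaStar μ pibar r)
      = Matrix.blockDiagonal (fun _ : Fin K => (M.SigmaS μ r)⁻¹)
        * Matrix.blockDiagonal (M.Ibar μ pibar r)
        * (Matrix.blockDiagonal (fun _ : Fin K => (M.SigmaS μ r)⁻¹))ᵀ := by
  rw [Matrix.blockDiagonal_transpose, ← Matrix.blockDiagonal_mul, ← Matrix.blockDiagonal_mul]
  simp only [Matrix.transpose_nonsing_inv, SigmaS_transpose]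
  rfl

theorem posSemidef_blockDiagonal_SigmaStar (hM : M.IsNoisyContextBandit μ) (hreg : M.Regular μ)
    (hp0 : 0 < pmin) (hpm : ∀ t a, ∀ᵐ ω ∂μ, pmin ≤ M.selProb t a ω)
    (hconv : M.PolicyConverges μ pibar) (r : ℕ) :
    (Matrix.blockDiagonal (M.SigmaStar μ pibar r)).PosSemidef := by
  rw [blockDiagonal_SigmaStar, ← Matrix.conjTranspose_eq_transpose_of_trivial]
  exact (hM.posSemidef_blockDiagonal_Ibar hreg hp0 hpm hconv r).mul_mul_conjTranspose_same _

/-- Cramér–Wold reduction: each linear functional of the stacked score is a scalar sum of the kind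
covered by `tendsto_integral_exp_weighted`. -/
theorem inner_stackedScore (M : Model d K Ω) (T : ℕ) (ω : Ω)
    (u : EuclideanSpace ℝ (Fin d × Fin K)) :
    inner ℝ (M.stackedScore T ω) u = (1 / √(T : ℝ)) * ∑ t ∈ Finset.range T, ∑ a,
      M.weight a t ω * ∑ i, u (i, a) * M.score (M.obsPair t ω).1 (M.obsPair t ω).2
        (M.theta a) i := by
  have hT : √(T : ℝ) * (1 / (T : ℝ)) = 1 / √(T : ℝ) := by
    rw [mul_one_div, Real.sqrt_div_self, one_div]
  rw [EuclideanSpace.inner_eq_star_dotProduct]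
  simp only [star_trivial, dotProduct, stackedScore, G_apply]
  rw [Fintype.sum_prod_type_right, Finset.sum_comm (s := Finset.range T), Finset.mul_sum]
  refine Finset.sum_congr rfl fun a _ => ?_
  simp_rw [Finset.mul_sum]
  rw [Finset.sum_comm]
  refine Finset.sum_congr rfl fun t _ => Finset.sum_congr rfl fun i _ => ?_
  rw [← hT]
  ring

theorem tendstoInDistribution_stackedScore (hM : M.IsNoisyContextBandit μ) (hreg : M.Regular μ)
    (hp0 : 0 < pmin) (hpm : ∀ t a, ∀ᵐ ω ∂μ, pmin ≤ M.selProb t a ω)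
    (hconv : M.PolicyConverges μ pibar) (r : ℕ) :
    TendstoInDistribution M.stackedScore atTop id (fun _ => μ)
      (multivariateGaussian 0 (Matrix.blockDiagonal (M.Ibar μ pibar r))) where
  forall_aemeasurable := hM.aemeasurable_stackedScore
  aemeasurable_limit := aemeasurable_id
  tendsto := by
    refine ProbabilityMeasure.tendsto_iff_tendsto_charFun.2 fun u => ?_
    let f : Fin K → Vec d × ℝ → ℝ := fun a q => ∑ i, u (i, a) * M.score q.1 q.2 (M.theta a) i
    have hf : ∀ a, Measurable (f a) := fun a =>
      Finset.measurable_fun_sum _ fun i _ => (M.measurable_score _ i).const_mul _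
    have hf4 : ∀ a, MemLp (fun ω => f a (M.armPair a r ω)) 4 μ := fun a =>
      memLp_finsetSum _ fun i _ => (hM.memLp_score hreg a r i).const_mul _
    have hmean : ∀ a, ∫ ω, f a (M.armPair a r ω) ∂μ = 0 := by
      intro a
      change ∫ ω, ∑ i, u (i, a)
        * M.score (M.X r ω) (M.potentialOutcome r ω a) (M.theta a) i ∂μ = 0
      rw [integral_finsetSum _ fun i _ =>
        ((hM.memLp_score hreg a r i).integrable (by norm_num)).const_mul _]
      refine Finset.sum_eq_zero fun i _ => ?_
      rw [integral_const_mul, hM.integral_score hreg, mul_zero]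
    have hlim := hM.tendsto_integral_exp_weighted hp0 hpm hconv r hf hf4 hmean
    have hvar := hM.dotProduct_blockDiagonal_Ibar hreg hp0 hpm hconv r u.ofLp
    simp only [ProbabilityMeasure.coe_mk, Measure.map_id]
    rw [charFun_multivariateGaussian (hM.posSemidef_blockDiagonal_Ibar hreg hp0 hpm hconv r), hvar]
    simp only [inner_zero_right, Complex.ofReal_zero, zero_mul, zero_sub]
    rw [← neg_div]
    refine hlim.congr fun T => ?_
    rw [charFun_apply, integral_map (hM.aemeasurable_stackedScore T)
      (Measurable.aestronglyMeasurable (by fun_prop))]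
    simp_rw [inner_stackedScore]
    rfl

end IsNoisyContextBandit

end Model

/-! ### Asymptotic normality and consistency of the plug-in variance -/

namespace Model

variable {d K : ℕ} {Ω : Type*} {mΩ : MeasurableSpace Ω} {μ : Measure Ω} {M : Model d K Ω}

theorem score_eq_sub (M : Model d K Ω) (x : Vec d) (y : ℝ) (θ θ' : Vec d) (i : Fin d) :
    M.score x y θ' i = M.score x y θ i
      - ∑ k, (outer x i k - M.SigmaE i k) * (θ' k - θ k) := by
  simp only [score_apply, mul_sub, Finset.sum_sub_distrib]
  ring

theorem Ihat_apply (M : Model d K Ω) (est : ℕ → Fin K → Ω → Vec d) (a : Fin K) (T : ℕ) (ω : Ω)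
    (i j : Fin d) : M.Ihat est a T ω i j = (1 / (T : ℝ)) * ∑ t ∈ Finset.range T,
      (if M.A t ω = a then 1 else 0) / M.selProb t (M.A t ω) ω ^ 2
        * (M.score (M.X t ω) (M.Y t ω) (est T a ω) i
          * M.score (M.X t ω) (M.Y t ω) (est T a ω) j) := by
  simp only [Ihat, Matrix.smul_apply, Matrix.sum_apply, smul_eq_mul]
  congr 1
  refine Finset.sum_congr rfl fun t _ => ?_
  congr 1
  simp only [outer_apply, score, PiLp.sub_apply]
  ring

theorem IsIPWZEstimator.tendstoInMeasure_apply {est : ℕ → Fin K → Ω → Vec d}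
    (hest : M.IsIPWZEstimator μ est) (a : Fin K) (i : Fin d) :
    TendstoInMeasure μ (fun (T : ℕ) ω => √(T : ℝ) * M.G a T (est T a ω) ω i) atTop
      (fun _ => 0) := by
  have h := TendstoInMeasure.comp_continuousAt (hest.estimating_equation a)
    (g := fun x : Vec d => x i) (by fun_prop : Continuous fun x : Vec d => x i).continuousAt
  exact h

/-- Dropping the factor √T ≥ 1 only makes the quantity smaller. -/
theorem IsIPWZEstimator.tendstoInMeasure_G_apply {est : ℕ → Fin K → Ω → Vec d}
    (hest : M.IsIPWZEstimator μ est) (a : Fin K) (i : Fin d) :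
    TendstoInMeasure μ (fun (T : ℕ) ω => M.G a T (est T a ω) ω i) atTop (fun _ => 0) := by
  intro ε hε
  refine tendsto_of_tendsto_of_tendsto_of_le_of_le' tendsto_const_nhds
    (hest.tendstoInMeasure_apply a i ε hε) (Eventually.of_forall fun _ => zero_le) ?_
  filter_upwards [eventually_ge_atTop 1] with T hT
  refine measure_mono fun ω hω => le_trans (show ε ≤ _ from hω) ?_
  have hT' : (1 : ℝ) ≤ √(T : ℝ) := Real.one_le_sqrt.2 (by exact_mod_cast hT)
  rw [edist_zero_right, edist_zero_right, enorm_le_iff_norm_le, norm_mul,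
    Real.norm_of_nonneg (Real.sqrt_nonneg _)]
  exact le_mul_of_one_le_left (norm_nonneg _) hT'

namespace IsNoisyContextBandit

variable [IsProbabilityMeasure μ] {pmin : ℝ} {pibar : StationaryPolicy d K}

theorem tendstoInDistribution_stackedError (hM : M.IsNoisyContextBandit μ) (hreg : M.Regular μ)
    (hp0 : 0 < pmin) (hpm : ∀ t a, ∀ᵐ ω ∂μ, pmin ≤ M.selProb t a ω)
    (hconv : M.PolicyConverges μ pibar) (r : ℕ) {est : ℕ → Fin K → Ω → Vec d}
    (hest : M.IsIPWZEstimator μ est) :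
    TendstoInDistribution (M.stackedError est) atTop id (fun _ => μ)
      (multivariateGaussian 0 (Matrix.blockDiagonal (M.SigmaStar μ pibar r))) := by
  -- Everything that converges in probability to a constant: the inverse matrices and the residuals
  -- √T G(est). The map `g` below recombines it with the stacked score into the rescaled error.
  let N : ℕ → Ω → (Fin K → Fin d → Fin d → ℝ) × (Fin K → Fin d → ℝ) := fun T ω =>
    (fun a i j => (M.Gdot a T ω)⁻¹ i j, fun a i => √(T : ℝ) * M.G a T (est T a ω) ω i)
  let c : (Fin K → Fin d → Fin d → ℝ) × (Fin K → Fin d → ℝ) := (fun _ i j => (M.SigmaS μ r)⁻¹ i j, fun _ _ => 0)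
  let g : EuclideanSpace ℝ (Fin d × Fin K) × (Fin K → Fin d → Fin d → ℝ) × (Fin K → Fin d → ℝ) →
      EuclideanSpace ℝ (Fin d × Fin K) := fun q =>
    WithLp.toLp 2 fun p => ∑ j, q.2.1 p.2 p.1 j * (q.1 (j, p.2) - q.2.2 p.2 j)
  have hg : Continuous g := by
    refine (PiLp.continuous_toLp 2 _).comp (continuous_pi fun p => ?_)
    fun_prop
  have hN : TendstoInMeasure μ N atTop (fun _ => c) :=
    TendstoInMeasure.prodMk_const
      (TendstoInMeasure.pi fun a => TendstoInMeasure.pi fun i => TendstoInMeasure.pi fun j =>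
        hM.tendstoInMeasure_Gdot_inv hreg hp0 hpm r a i j)
      (TendstoInMeasure.pi fun a => TendstoInMeasure.pi fun i =>
        hest.tendstoInMeasure_apply a i)
  have hNm : ∀ T, AEMeasurable (N T) μ := by
    intro T
    refine AEMeasurable.prodMk ?_ ?_
    · refine Measurable.aemeasurable (measurable_pi_lambda _ fun a => measurable_pi_lambda _
        fun i => measurable_pi_lambda _ fun j => ?_)
      exact measurable_matrix_inv_apply (hM.measurable_Gdot_apply a T) i j
    · refine aemeasurable_pi_lambda _ fun a => aemeasurable_pi_lambda _ fun i => ?_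
      exact (hM.aemeasurable_G_apply a T (hest.aemeasurable T a) i).const_mul _
  have hslutsky := (hM.tendstoInDistribution_stackedScore hreg hp0 hpm hconv r
    ).continuous_comp_prodMk_of_tendstoInMeasure_const hg hN hNm
  have hm : ∀ T, AEMeasurable (M.stackedError est T) μ := by
    intro T
    refine (WithLp.measurable_toLp 2 _).comp_aemeasurable (aemeasurable_pi_lambda _ fun p => ?_)
    have := hest.aemeasurable T p.2
    fun_prop
  -- The exact linear identity holds off the singular event, so the difference is zero there.
  have hsub : TendstoInMeasure μ
      (M.stackedError est - fun T ω => g (M.stackedScore T ω, N T ω)) atTop 0 := by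
    refine TendstoInMeasure.congr_of_measure_ne (tendstoInMeasure_const 0)
      (hM.tendsto_measure_singularEvent hreg hp0 hpm) fun T ω hω => ?_
    simp only [Pi.sub_apply]
    rw [eq_comm, sub_eq_zero]
    apply WithLp.ofLp_injective
    ext p
    have h := congr_fun (M.sub_eq_inv_mulVec (isUnit_of_notMem_singularEvent hω p.2)
      (M.theta p.2) (est T p.2 ω)) p.1
    simp only [Pi.sub_apply, Matrix.mulVec, dotProduct] at h
    simp only [stackedError, stackedScore, g, N]
    rw [h, Finset.mul_sum]
    exact Finset.sum_congr rfl fun j _ => by ring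
  have hlim := tendstoInDistribution_of_tendstoInMeasure_sub (M.stackedError est) _ hslutsky hsub hm
  -- At the limiting constants, `g` is multiplication by the block diagonal matrix of Σ_S⁻¹, which
  -- maps the Gaussian limit of the score to the claimed one.
  have hgc : (fun z : EuclideanSpace ℝ (Fin d × Fin K) => g (id z, c))
      = fun z => WithLp.toLp 2
        (Matrix.blockDiagonal (fun _ : Fin K => (M.SigmaS μ r)⁻¹) *ᵥ z.ofLp) := by
    ext z p
    simp only [g, c, blockDiagonal_mulVec_apply, id, sub_zero]
  have hlaw : (multivariateGaussian 0 (Matrix.blockDiagonal (M.Ibar μ pibar r))).map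
      (fun z => g (id z, c))
      = (multivariateGaussian 0 (Matrix.blockDiagonal (M.SigmaStar μ pibar r))).map id := by
    rw [hgc, map_multivariateGaussian_mulVec
      (hM.posSemidef_blockDiagonal_Ibar hreg hp0 hpm hconv r), Measure.map_id,
      blockDiagonal_SigmaStar]
  refine ⟨hm, aemeasurable_id, ?_⟩
  have h := hlim.tendsto
  have heq : (⟨_, Measure.isProbabilityMeasure_map hlim.aemeasurable_limit⟩ :
        ProbabilityMeasure (EuclideanSpace ℝ (Fin d × Fin K)))
      = ⟨_, Measure.isProbabilityMeasure_map (aemeasurable_id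
        (μ := multivariateGaussian 0 (Matrix.blockDiagonal (M.SigmaStar μ pibar r))))⟩ :=
    Subtype.ext hlaw
  rw [heq] at h
  exact h

theorem tendstoInMeasure_est_sub (hM : M.IsNoisyContextBandit μ) (hreg : M.Regular μ)
    (hp0 : 0 < pmin) (hpm : ∀ t a, ∀ᵐ ω ∂μ, pmin ≤ M.selProb t a ω)
    {est : ℕ → Fin K → Ω → Vec d} (hest : M.IsIPWZEstimator μ est) (a : Fin K) (i : Fin d) :
    TendstoInMeasure μ (fun T ω => est T a ω i - M.theta a i) atTop (fun _ => 0) := by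
  have h : TendstoInMeasure μ (fun T ω => ∑ j, (M.Gdot a T ω)⁻¹ i j
      * (M.G a T (M.theta a) ω j - M.G a T (est T a ω) ω j)) atTop
      (fun _ => ∑ j, (M.SigmaS μ 0)⁻¹ i j * (0 - 0)) :=
    TendstoInMeasure.sum_of_const fun j =>
      (hM.tendstoInMeasure_Gdot_inv hreg hp0 hpm 0 a i j).mul_of_const
        ((hM.tendstoInMeasure_G hreg hp0 hpm a j).sub_of_const
          (hest.tendstoInMeasure_G_apply a j))
  simp only [sub_zero, mul_zero, Finset.sum_const_zero] at h
  refine TendstoInMeasure.congr_of_measure_ne h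
    (hM.tendsto_measure_singularEvent hreg hp0 hpm) fun T ω hω => ?_
  exact (congr_fun (M.sub_eq_inv_mulVec (isUnit_of_notMem_singularEvent hω a)
    (M.theta a) (est T a ω)) i).symm

/-- Substituting est = θ* + δ makes the entry an exact quadratic polynomial in δ, whose coefficients
are averages weighted by 1_{A_t = a}/π_t² and therefore converge. The constant coefficient tends to
`Ibar`, while the others are multiplied by δ → 0. -/
theorem tendstoInMeasure_Ihat (hM : M.IsNoisyContextBandit μ) (hreg : M.Regular μ)
    (hp0 : 0 < pmin) (hpm : ∀ t a, ∀ᵐ ω ∂μ, pmin ≤ M.selProb t a ω)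
    (hconv : M.PolicyConverges μ pibar) (r : ℕ) {est : ℕ → Fin K → Ω → Vec d}
    (hest : M.IsIPWZEstimator μ est) (a : Fin K) (i j : Fin d) :
    TendstoInMeasure μ (fun T ω => M.Ihat est a T ω i j) atTop
      (fun _ => M.Ibar μ pibar r a i j) := by
  let s : Fin d → Vec d × ℝ → ℝ := fun i q => M.score q.1 q.2 (M.theta a) i
  let B : Fin d → Fin d → Vec d × ℝ → ℝ := fun i k q => outer q.1 i k - M.SigmaE i k
  let avg : (Vec d × ℝ → ℝ) → ℕ → Ω → ℝ := fun f T ω => (1 / (T : ℝ)) *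
    ∑ t ∈ Finset.range T, (if M.A t ω = a then 1 else 0) / M.selProb t (M.A t ω) ω ^ 2
      * f (M.obsPair t ω)
  have hs : ∀ i, Measurable (s i) := fun i => M.measurable_score _ i
  have hB : ∀ i k, Measurable (B i k) := fun i k =>
    ((measurable_outer i k).comp measurable_fst).sub_const _
  have hs4 : ∀ i, MemLp (fun ω => s i (M.armPair a r ω)) 4 μ := fun i => hM.memLp_score hreg a r i
  have hBt : ∀ i k, MemLp (fun ω => B i k (M.armPair a r ω)) ⊤ μ := fun i k =>
    hM.memLp_outer_sub hreg r i k
  have h0 := hM.tendstoInMeasure_average_weight_div hp0 hpm hconv r a (f := fun q => s i q * s j q)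
    ((hs i).mul (hs j)) (memLp_two_mul_of_memLp_four (hs4 i) (hs4 j))
  have h1 := fun i j l => hM.tendstoInMeasure_average_weight_div hp0 hpm hconv r a
    (f := fun q => B j l q * s i q) ((hB j l).mul (hs i))
    ((memLp_top_mul (hBt j l) (hs4 i)).mono_exponent (by norm_num))
  have h2 := fun k l => hM.tendstoInMeasure_average_weight_div hp0 hpm hconv r a
    (f := fun q => B i k q * B j l q) ((hB i k).mul (hB j l))
    ((memLp_top_mul (hBt i k) (hBt j l)).mono_exponent le_top)
  have hδ := hM.tendstoInMeasure_est_sub hreg hp0 hpm hest a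
  -- Constant, two linear and quadratic parts of the polynomial. The factor −1 gives the quadratic
  -- part the sign needed for a subtraction like the others.
  have hcomb := ((h0.sub_of_const
      (TendstoInMeasure.sum_of_const fun l => (hδ l).mul_of_const (h1 i j l))
    ).sub_of_const
      (TendstoInMeasure.sum_of_const fun k => (hδ k).mul_of_const (h1 j i k))
    ).sub_of_const (TendstoInMeasure.sum_of_const fun k =>
      TendstoInMeasure.sum_of_const fun l =>
        ((tendstoInMeasure_const (-1 : ℝ)).mul_of_const
          ((hδ k).mul_of_const (hδ l))).mul_of_const (h2 k l))
  simp only [mul_zero, zero_mul, Finset.sum_const_zero, sub_zero] at hcomb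
  have hlim : M.Ibar μ pibar r a i j = ∫ ω, 1 / pibar.prob (M.X r ω) a
      * (s i (M.armPair a r ω) * s j (M.armPair a r ω)) ∂μ :=
    hM.Ibar_apply hreg hp0 hpm hconv r a i j
  rw [hlim]
  refine hcomb.congr_left fun T => ae_of_all _ fun ω => ?_
  beta_reduce
  rw [Ihat_apply]
  simp only [score_eq_sub M _ _ (M.theta a) (est T a ω)]
  set δ : Fin d → ℝ := fun k => est T a ω k - M.theta a k with hδdef
  have havg : ∀ (x : ℝ) (f : Vec d × ℝ → ℝ), x * avg f T ω = avg (fun q => x * f q) T ω := by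
    intro x f
    simp only [avg, Finset.mul_sum]
    exact Finset.sum_congr rfl fun t _ => by ring
  have hsum : ∀ f : Fin d → Vec d × ℝ → ℝ,
      ∑ k, avg (f k) T ω = avg (fun q => ∑ k, f k q) T ω := by
    intro f
    simp only [avg, Finset.mul_sum]
    rw [Finset.sum_comm]
  have hsubt : ∀ f f' : Vec d × ℝ → ℝ,
      avg f T ω - avg f' T ω = avg (fun q => f q - f' q) T ω := by
    intro f f'
    simp only [avg, mul_sub, Finset.sum_sub_distrib]
  change avg (fun q => s i q * s j q) T ω - ∑ l, δ l * avg (fun q => B j l q * s i q) T ω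
      - ∑ k, δ k * avg (fun q => B i k q * s j q) T ω
      - ∑ k, ∑ l, -1 * (δ k * δ l) * avg (fun q => B i k q * B j l q) T ω
    = avg (fun q => (s i q - ∑ k, B i k q * δ k) * (s j q - ∑ l, B j l q * δ l)) T ω
  simp only [havg, hsum, hsubt]
  have hpt : ∀ q, s i q * s j q - ∑ l, δ l * (B j l q * s i q)
      - ∑ k, δ k * (B i k q * s j q) - ∑ k, ∑ l, -1 * (δ k * δ l) * (B i k q * B j l q)
      = (s i q - ∑ k, B i k q * δ k) * (s j q - ∑ l, B j l q * δ l) := by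
    intro q
    rw [sub_mul, mul_sub, mul_sub, Finset.sum_mul_sum, Finset.mul_sum, Finset.sum_mul]
    have e1 : ∑ l, s i q * (B j l q * δ l) = ∑ l, δ l * (B j l q * s i q) :=
      Finset.sum_congr rfl fun l _ => by ring
    have e2 : ∑ k, B i k q * δ k * s j q = ∑ k, δ k * (B i k q * s j q) :=
      Finset.sum_congr rfl fun k _ => by ring
    have e3 : ∑ k, ∑ l, B i k q * δ k * (B j l q * δ l)
        = - ∑ k, ∑ l, -1 * (δ k * δ l) * (B i k q * B j l q) := by
      rw [← Finset.sum_neg_distrib]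
      refine Finset.sum_congr rfl fun k _ => ?_
      rw [← Finset.sum_neg_distrib]
      exact Finset.sum_congr rfl fun l _ => by ring
    rw [e1, e2, e3]
    ring
  simp only [hpt]

theorem tendstoInMeasure_SigmaHat (hM : M.IsNoisyContextBandit μ) (hreg : M.Regular μ)
    (hp0 : 0 < pmin) (hpm : ∀ t a, ∀ᵐ ω ∂μ, pmin ≤ M.selProb t a ω)
    (hconv : M.PolicyConverges μ pibar) (r : ℕ) {est : ℕ → Fin K → Ω → Vec d}
    (hest : M.IsIPWZEstimator μ est) (a : Fin K) (i j : Fin d) :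
    TendstoInMeasure μ (fun T ω => M.SigmaHat est a T ω i j) atTop
      (fun _ => M.SigmaStar μ pibar r a i j) := by
  have hinv := hM.tendstoInMeasure_Gdot_inv hreg hp0 hpm r a
  have hI := hM.tendstoInMeasure_Ihat hreg hp0 hpm hconv r hest a
  have h := TendstoInMeasure.sum_of_const fun k =>
    (TendstoInMeasure.sum_of_const fun l =>
      (hinv i l).mul_of_const (hI l k)).mul_of_const (hinv j k)
  have hlim : M.SigmaStar μ pibar r a i j
      = ∑ k, (∑ l, (M.SigmaS μ r)⁻¹ i l * M.Ibar μ pibar r a l k) * (M.SigmaS μ r)⁻¹ j k := by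
    -- Symmetry of Σ_S removes the transpose from the limit.
    have hsymm : (M.SigmaS μ r)⁻¹ = ((M.SigmaS μ r)⁻¹)ᵀ := by
      rw [Matrix.transpose_nonsing_inv, SigmaS_transpose]
    simp only [SigmaStar, Matrix.mul_apply]
    refine Finset.sum_congr rfl fun k _ => ?_
    congr 1
    exact congr_fun (congr_fun hsymm k) j
  rw [hlim]
  refine h.congr_left fun T => ae_of_all _ fun ω => ?_
  simp only [SigmaHat, Matrix.mul_apply, Matrix.transpose_apply]

end IsNoisyContextBandit

end Model

end NoisyBandit

end

theorem corollary2 {d K : ℕ} {Ω : Type*} {mΩ : MeasurableSpace Ω}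
    (μ : Measure Ω) [IsProbabilityMeasure μ]
    (M : NoisyBandit.Model d K Ω) (hM : M.IsNoisyContextBandit μ) (hreg : M.Regular μ)
    (hmin : M.MinSamplingProb μ)
    (pibar : NoisyBandit.StationaryPolicy d K) (hconv : M.PolicyConverges μ pibar)
    (r : ℕ) :
    M.IsIPWZEstimator μ M.ipwEstimator ∧
    (Matrix.blockDiagonal (M.SigmaStar μ pibar r)).PosSemidef ∧
    ∀ est : ℕ → Fin K → Ω → NoisyBandit.Vec d, M.IsIPWZEstimator μ est →
      TendstoInDistribution (M.stackedError est) atTop id (fun _ => μ)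
        (multivariateGaussian 0 (Matrix.blockDiagonal (M.SigmaStar μ pibar r))) ∧
      ∀ a i j, TendstoInMeasure μ (fun T ω => M.SigmaHat est a T ω i j) atTop
        (fun _ => M.SigmaStar μ pibar r a i j) := by
  obtain ⟨pmin, ⟨hp0, _⟩, hpm⟩ := hmin
  exact ⟨hM.isIPWZEstimator_ipwEstimator hreg hp0 hpm,
    hM.posSemidef_blockDiagonal_SigmaStar hreg hp0 hpm hconv r,
    fun est hest => ⟨hM.tendstoInDistribution_stackedError hreg hp0 hpm hconv r hest,
      fun a i j => hM.tendstoInMeasure_SigmaHat hreg hp0 hpm hconv r hest a i j⟩⟩
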